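/- Let $\Lambda$ be the Leech lattice, $O(\Lambda)$ its isometry group, and let $g\in O(\Lambda)$ belong to one of the conjugacy classes $4C$, $6E$, $6G$, $8E$, $10F$ (ATLAS notation; the Frame shapes are $1^42^24^4$, $1^22^23^26^2$, $2^36^3$, $1^2\,2\,4\,8^2$, $2^210^2$ respectively. With $\Lambda$ in its standard coordinates, $4C$, $6E$, $8E$, $10F$ are the classes containing the permutations in $M_{24}$ with these cycle shapes, and $6G$ is the class containing the products, of Frame shape $2^36^3$, of a permutation in $M_{24}$ of cycle shape $1^63^6$ with a sign change on a Golay codeword). Let $\Lambda^g=\{x\in\Lambda\mid gx=x\}$ and let $\Lambda_g=\{x\in\Lambda\mid (x|y)=0\text{ for all }y\in\Lambda^g\}$ be the coinvariant lattice. Let $k_1,\dots,k_t\ge 2$, let $R=\bigoplus_{i=1}^t R_i$ be the orthogonal sum of the root lattices $R_i$ of type $A_{k_i-1}$ with simple roots $\Delta_i=\{\alpha^i_1,\dots,\alpha^i_{k_i-1}\}$, fundamental weights $\lambda^i_1,\dots,\lambda^i_{k_i-1}$ and Weyl vector $\rho_i$, and put $\chi_\Delta=(\rho_1/k_1,\dots,\rho_t/k_t)$.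 Identify $R^*/R$ with $\bigoplus_i\mathbb{Z}/k_i\mathbb{Z}$ so that $\lambda^i_j+R$ corresponds to $j$ in the $i$-th summand. For $c=(c_1,\dots,c_t)\in R^*/R$ with $1\le c_i<k_i$ and $\gcd(c_i,k_i)=1$, let $C=\langle c\rangle$, let $L_A(C)\subset R^*$ be the preimage of $C$, let $L_B(C)=\{v\in L_A(C)\mid (v|\chi_\Delta)\in\mathbb{Z}\}$, and let $g_{\Delta,c}=(g_{\Delta_1}^{c_1},\dots,g_{\Delta_t}^{c_t})$, where $g_{\Delta_i}=r_{\alpha^i_1}\cdots r_{\alpha^i_{k_i-1}}$ is the Coxeter element of the Weyl group of $R_i$ (a product of simple reflections). Take $(R,c)$ according to the class of $g$ as follows: $4C$: $R=A_3^4A_1^2$, $c=(1,1,1,1\,|\,1,1)$; $6E$: $R=A_5^2A_2^2A_1^2$, $c=(1,1\,|\,1,1\,|\,1,1)$; $6G$: $R=A_5^3A_1^3$, $c=(1,1,1\,|\,1,1,1)$; $8E$: $R=A_7^2A_3A_1$, $c=(1,3\,|\,1\,|\,1)$; $10F$: $R=A_9^2A_1^2$, $c=(1,3\,|\,1,1)$.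 Then $L_A(C)$ is an even lattice, and there is an isometry $f$ from $\Lambda_g$ onto $L_B(C)$ such that $f(gx)=g_{\Delta,c}f(x)$ for all $x\in\Lambda_g$. -/

import Mathlib

/-! ## Lattices in a rational space with a symmetric bilinear form -/

section Lattices

variable {V : Type*} [AddCommGroup V] [Module ℚ V]

/-- The dual lattice `L^* = {v ∈ ℚ ⊗ L | (v | L) ⊆ ℤ}`. -/
def dualLattice (B : LinearMap.BilinForm ℚ V) (L : Submodule ℤ V) : Submodule ℤ V where
  carrier := {v | v ∈ Submodule.span ℚ (L : Set V) ∧ ∀ w ∈ L, ∃ m : ℤ, B v w = m}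
  zero_mem' := ⟨Submodule.zero_mem _, fun w _ => ⟨0, by simp⟩⟩
  add_mem' := by
    rintro a b ⟨ha, ha'⟩ ⟨hb, hb'⟩
    refine ⟨Submodule.add_mem _ ha hb, fun w hw => ?_⟩
    obtain ⟨m, hm⟩ := ha' w hw
    obtain ⟨n, hn⟩ := hb' w hw
    exact ⟨m + n, by simp [hm, hn]⟩
  smul_mem' := by
    rintro c a ⟨ha, ha'⟩
    refine ⟨zsmul_mem ha c, fun w hw => ?_⟩
    obtain ⟨m, hm⟩ := ha' w hw
    exact ⟨c * m, by simp [hm]⟩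

/-- `L` is even: `(v | v) ∈ 2ℤ` for all `v ∈ L`. -/
def IsEvenLattice (B : LinearMap.BilinForm ℚ V) (L : Submodule ℤ V) : Prop :=
  ∀ v ∈ L, ∃ m : ℤ, B v v = 2 * m

/-- The isometry group `O(L)`. -/
def isometryGroup (B : LinearMap.BilinForm ℚ V) (L : Submodule ℤ V) : Subgroup (L ≃ₗ[ℤ] L) where
  carrier := {g | ∀ x y : L, B (g x : V) (g y : V) = B (x : V) (y : V)}
  one_mem' := fun _ _ => rfl
  mul_mem' := by
    intro g h hg hh x y
    exact (hg (h x) (h y)).trans (hh x y)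
  inv_mem' := by
    intro g hg x y
    have h := hg (g⁻¹ x) (g⁻¹ y)
    have e : ∀ z : L, g (g⁻¹ z) = z := fun z => g.apply_symm_apply z
    rw [e, e] at h
    exact h.symm

/-- The coinvariant lattice `L_g`: the vectors of `L` orthogonal to all vectors fixed by `g`. -/
def coinvariantLattice {B : LinearMap.BilinForm ℚ V} {L : Submodule ℤ V}
    (g : isometryGroup B L) : Submodule ℤ L where
  carrier := {x | ∀ w : L, g.1 w = w → B (x : V) (w : V) = 0}
  zero_mem' := fun w _ => by simp
  add_mem' := by
    intro a b ha hb w hw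
    simp [ha w hw, hb w hw]
  smul_mem' := by
    intro c a ha w hw
    simp [ha w hw]

/-- The action of `g` on its coinvariant lattice `L_g`. -/
def coinvariantRestrict {B : LinearMap.BilinForm ℚ V} {L : Submodule ℤ V}
    (g : isometryGroup B L) : coinvariantLattice g →ₗ[ℤ] coinvariantLattice g :=
  (g.1 : L →ₗ[ℤ] L).restrict (by
    intro x hx w hw
    have h := g.2 x w
    rw [hw] at h
    exact h.trans (hx w hw))

/-- The reflection `r_α : v ↦ v - 2 (v | α) / (α | α) α`. -/
def rootReflection (B : LinearMap.BilinForm ℚ V) (α : V) : Module.End ℚ V :=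
  LinearMap.id - ((2 / B α α) • B.flip α).smulRight α

/-- A linear automorphism of the ambient space that preserves the form and maps `L` onto itself
induces an isometry of `L`. -/
def isometryOfLinearEquiv {B : LinearMap.BilinForm ℚ V} {L : Submodule ℤ V} (e : V ≃ₗ[ℚ] V)
    (hB : ∀ x y, B (e x) (e y) = B x y) (h : ∀ x ∈ L, e x ∈ L) (h' : ∀ x ∈ L, e.symm x ∈ L) :
    isometryGroup B L :=
  ⟨{ toFun := fun x => ⟨e x, h x x.2⟩
     invFun := fun x => ⟨e.symm x, h' x x.2⟩
     left_inv := fun x => by simp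
     right_inv := fun x => by simp
     map_add' := fun x y => by ext; simp
     map_smul' := fun c x => by ext; simp }, fun x y => hB x y⟩

end Lattices

/-! ## The binary Golay code and the Leech lattice -/

/-- The `i`-th row of the generator matrix of the extended binary Golay code: the coefficients of
`x^i (1 + x^2 + x^4 + x^5 + x^6 + x^10 + x^11)` in the places `0, …, 22`, and the parity
bit `1` in the place `23`. -/
def golayRow (i : Fin 12) : Fin 24 → ZMod 2 := fun p =>
  if (p : ℕ) = 23 ∨ (p : ℕ) ∈ [0, 2, 4, 5, 6, 10, 11].map (fun e => (i : ℕ) + e) then 1 else 0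

/-- The extended binary Golay code of length 24. -/
def golayCode : Submodule (ZMod 2) (Fin 24 → ZMod 2) :=
  Submodule.span (ZMod 2) (Set.range golayRow)

/-- The Mathieu group `M₂₄`, the automorphism group of the Golay code. -/
def mathieu24 : Subgroup (Equiv.Perm (Fin 24)) where
  carrier := {σ | ∀ y : Fin 24 → ZMod 2, y ∘ σ ∈ golayCode ↔ y ∈ golayCode}
  one_mem' := fun _ => Iff.rfl
  mul_mem' := by
    intro σ τ hσ hτ y
    exact (hτ (y ∘ σ)).trans (hσ y)
  inv_mem' := by
    intro σ hσ y
    have h := hσ (y ∘ (σ⁻¹ : Equiv.Perm (Fin 24)))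
    have e : (y ∘ (σ⁻¹ : Equiv.Perm (Fin 24))) ∘ σ = y := by
      funext p; simp
    rw [e] at h
    exact h.symm

/-- The standard bilinear form `∑ x_p y_p` on `ℚ^ι`. -/
def stdForm (ι : Type*) [Fintype ι] : LinearMap.BilinForm ℚ (ι → ℚ) := dotProductBilin ℚ ℚ

/-- The form `(x | y) = (1/8) ∑ x_p y_p` of the Leech lattice in its standard coordinates. -/
def leechForm : LinearMap.BilinForm ℚ (Fin 24 → ℚ) := (1 / 8 : ℚ) • stdForm (Fin 24)

/-- The Leech lattice: the integral vectors `x = m (1, …, 1) + 2 y` such that `y mod 2` is a word of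
the Golay code and `∑ x_p ≡ 4 m mod 8`, with the form `(1/8) ∑ x_p y_p`. -/
def leech : Submodule ℤ (Fin 24 → ℚ) where
  carrier := {x | ∃ (m : ℤ) (y : Fin 24 → ℤ), (∀ p, x p = ((m + 2 * y p : ℤ) : ℚ)) ∧
    (fun p => (y p : ZMod 2)) ∈ golayCode ∧ ∑ p, (m + 2 * y p) ≡ 4 * m [ZMOD 8]}
  zero_mem' := ⟨0, 0, by simp, by convert golayCode.zero_mem using 1; funext p; simp, by simp [Int.ModEq]⟩
  add_mem' := by
    rintro a b ⟨m, y, h1, h2, h3⟩ ⟨n, z, k1, k2, k3⟩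
    refine ⟨m + n, y + z, fun p => ?_, ?_, ?_⟩
    · simp only [Pi.add_apply, h1, k1]; push_cast; ring
    · have := golayCode.add_mem h2 k2
      convert this using 1
      funext p; simp
    · have := h3.add k3
      rw [← Finset.sum_add_distrib] at this
      convert this using 1
      · exact Finset.sum_congr rfl fun p _ => by simp only [Pi.add_apply]; ring
      · ring
  smul_mem' := by
    rintro c a ⟨m, y, h1, h2, h3⟩
    refine ⟨c * m, fun p => c * y p, fun p => ?_, ?_, ?_⟩
    · simp only [Pi.smul_apply, h1, zsmul_eq_mul]; push_cast; ring
    · have := golayCode.smul_mem (c : ZMod 2) h2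
      convert this using 1
      funext p; simp
    · have := h3.mul_left c
      rw [Finset.mul_sum] at this
      convert this using 1
      · exact Finset.sum_congr rfl fun p _ => by ring
      · ring

/-- A permutation `σ ∈ M₂₄` of the coordinates, `(x_p) ↦ (x_{σ p})`, as an isometry of the
Leech lattice. -/
def leechPerm (σ : Equiv.Perm (Fin 24)) (hσ : σ ∈ mathieu24) : isometryGroup leechForm leech :=
  have key : ∀ τ ∈ mathieu24, ∀ x ∈ leech, (x ∘ τ : Fin 24 → ℚ) ∈ leech := by
    rintro τ hτ x ⟨m, y, h1, h2, h3⟩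
    refine ⟨m, y ∘ τ, fun p => h1 _, (hτ _).2 h2, ?_⟩
    rw [← Equiv.sum_comp τ] at h3
    exact h3
  isometryOfLinearEquiv (LinearEquiv.funCongrLeft ℚ ℚ σ)
    (fun x y => by
      simp only [leechForm, stdForm, LinearMap.smul_apply, dotProductBilin]
      exact congrArg _ (Equiv.sum_comp σ fun p => x p * y p))
    (fun x hx => key σ hσ x hx) (fun x hx => key σ⁻¹ (inv_mem hσ) x hx)

theorem golayCode_orthogonal_octad {w : Fin 24 → ZMod 2} (hw : w ∈ golayCode) :
    ∑ p, golayRow 0 p * w p = 0 := by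
  induction hw using Submodule.span_induction with
  | mem x hx =>
    obtain ⟨i, rfl⟩ := hx
    revert i
    decide +kernel
  | zero => simp
  | add x y _ _ hx hy => simp [mul_add, Finset.sum_add_distrib, hx, hy]
  | smul a x _ hx =>
    simp only [Pi.smul_apply, smul_eq_mul, mul_left_comm _ a, ← Finset.mul_sum, hx, mul_zero]

/-- The sign vector that is `-1` on the octad `{0, 2, 4, 5, 6, 10, 11, 23}` given by `golayRow 0`
and `1` elsewhere. -/
def octadSign (p : Fin 24) : ℤ := if golayRow 0 p = 1 then -1 else 1

theorem octadSign_mul_self (p : Fin 24) : octadSign p * octadSign p = 1 := by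
  unfold octadSign; split_ifs <;> rfl

/-- The sign change `(x_p) ↦ (octadSign p * x_p)` as a linear automorphism of the
ambient space. -/
def octadSignEquiv : (Fin 24 → ℚ) ≃ₗ[ℚ] (Fin 24 → ℚ) :=
  LinearEquiv.ofInvolutive
    { toFun := fun x p => (octadSign p : ℚ) * x p
      map_add' := fun x y => by funext p; simp [mul_add]
      map_smul' := fun c x => by funext p; simp [mul_left_comm] }
    (fun x => by
      funext p
      have h : ((octadSign p : ℚ)) * (octadSign p : ℚ) = 1 := by
        exact_mod_cast octadSign_mul_self p
      simp [← mul_assoc, h])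

/-- The sign change on the octad `{0, 2, 4, 5, 6, 10, 11, 23}` as an isometry of the
Leech lattice. -/
def leechSign : isometryGroup leechForm leech :=
  have key : ∀ x ∈ leech, octadSignEquiv x ∈ leech := by
    rintro x ⟨m, y, h1, h2, h3⟩
    have hval : ∀ p, octadSign p * (m + 2 * y p) =
        m + 2 * (if golayRow 0 p = 1 then - y p - m else y p) := by
      intro p
      unfold octadSign
      split_ifs <;> ring
    have h01 : ∀ p, golayRow 0 p = 0 ∨ golayRow 0 p = 1 := by decide
    refine ⟨m, fun p => if golayRow 0 p = 1 then - y p - m else y p, fun p => ?_, ?_, ?_⟩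
    · rw [← hval p]
      change (octadSign p : ℚ) * x p = _
      rw [h1 p]
      push_cast
      ring
    · have := golayCode.add_mem h2
        (golayCode.smul_mem (m : ZMod 2) (Submodule.subset_span ⟨0, rfl⟩))
      convert this using 1
      funext p
      rcases h01 p with h | h
      · simp [h]
      · simp [h, sub_eq_add_neg, ZMod.neg_eq_self_mod_two]
    · have ho := golayCode_orthogonal_octad h2
      have hc : ((∑ p, (if golayRow 0 p = 1 then y p else 0) : ℤ) : ZMod 2) = 0 := by
        rw [← ho]
        push_cast
        refine Finset.sum_congr rfl fun p _ => ?_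
        rcases h01 p with h | h <;> simp [h]
      obtain ⟨r, hr⟩ := (ZMod.intCast_zmod_eq_zero_iff_dvd _ 2).1 hc
      have h8 : ∑ p : Fin 24, (if golayRow 0 p = 1 then (1 : ℤ) else 0) = 8 := by decide +kernel
      have hs : ∑ p, (m + 2 * (if golayRow 0 p = 1 then - y p - m else y p)) =
          ∑ p, (m + 2 * y p) - 8 * (2 * m + r) := by
        have e : ∀ p, m + 2 * (if golayRow 0 p = 1 then - y p - m else y p) =
            (m + 2 * y p) - 4 * (if golayRow 0 p = 1 then y p else 0)
              - 2 * m * (if golayRow 0 p = 1 then (1 : ℤ) else 0) := by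
          intro p
          split_ifs <;> ring
        rw [Finset.sum_congr rfl fun p _ => e p, Finset.sum_sub_distrib, Finset.sum_sub_distrib,
          ← Finset.mul_sum, ← Finset.mul_sum, h8, hr]
        push_cast
        ring
      rw [hs]
      refine Int.ModEq.trans ?_ h3
      exact (Int.modEq_iff_dvd.2 ⟨2 * m + r, by ring⟩)
  isometryOfLinearEquiv octadSignEquiv
    (fun x y => by
      simp only [leechForm, stdForm, LinearMap.smul_apply, dotProductBilin]
      refine congrArg _ ?_
      change ∑ p, octadSignEquiv x p * octadSignEquiv y p = ∑ p, x p * y p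
      refine Finset.sum_congr rfl fun p _ => ?_
      have h : ((octadSign p : ℚ)) * (octadSign p : ℚ) = 1 := by
        exact_mod_cast octadSign_mul_self p
      change (octadSign p : ℚ) * x p * ((octadSign p : ℚ) * y p) = x p * y p
      linear_combination (x p * y p) * h)
    key key

/-- A permutation belongs to `M₂₄` if it maps the rows of the generator matrix to combinations of
its rows; the bits of `M i` are the coefficients. -/
theorem mem_mathieu24 (σ : Equiv.Perm (Fin 24)) (M : Fin 12 → ℕ)
    (h : ∀ i p, golayRow i (σ p) = ∑ l : Fin 12, if (M i).testBit l then golayRow l p else 0) :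
    σ ∈ mathieu24 := by
  have hle : golayCode ≤ golayCode.comap (LinearMap.funLeft (ZMod 2) (ZMod 2) σ) := by
    refine Submodule.span_le.2 ?_
    rintro _ ⟨i, rfl⟩
    have e : LinearMap.funLeft (ZMod 2) (ZMod 2) σ (golayRow i) =
        ∑ l : Fin 12, if (M i).testBit l then golayRow l else 0 := by
      funext p
      rw [LinearMap.funLeft_apply, h, Finset.sum_apply]
      exact Finset.sum_congr rfl fun l _ => by split_ifs <;> rfl
    change LinearMap.funLeft (ZMod 2) (ZMod 2) σ (golayRow i) ∈ golayCode
    rw [e]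
    refine Submodule.sum_mem _ fun l _ => ?_
    split_ifs
    · exact Submodule.subset_span ⟨l, rfl⟩
    · exact Submodule.zero_mem _
  have hpow : ∀ (n : ℕ) (y : Fin 24 → ZMod 2), y ∈ golayCode →
      y ∘ (σ ^ n : Equiv.Perm (Fin 24)) ∈ golayCode := by
    intro n
    induction n with
    | zero => intro y hy; exact hy
    | succ n ih =>
      intro y hy
      have := hle (ih y hy)
      rw [pow_succ]
      exact this
  intro y
  refine ⟨fun hy => ?_, fun hy => hle hy⟩
  have := hpow (orderOf σ - 1) _ hy
  have e : (y ∘ σ) ∘ (σ ^ (orderOf σ - 1) : Equiv.Perm (Fin 24)) = y := by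
    funext p
    have h1 : σ * σ ^ (orderOf σ - 1) = 1 := by
      rw [← pow_succ', Nat.sub_add_cancel (orderOf_pos σ), pow_orderOf_eq_one]
    exact congrArg y (congrArg (fun τ : Equiv.Perm (Fin 24) => τ p) h1)
  rwa [e] at this

/-! ## Representatives of the conjugacy classes `4C`, `6E`, `6G`, `8E`, `10F` of `O(Λ)` -/

/-- An element of `M₂₄` of cycle shape `1^4 2^2 4^4`. -/
def perm4C : Equiv.Perm (Fin 24) :=
  c[0, 20, 1, 18] * c[2, 21, 3, 13] * c[4, 8, 12, 19] * c[7, 16, 10, 15] * c[6, 22] * c[9, 11]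

/-- An element of `M₂₄` of cycle shape `1^2 2^2 3^2 6^2`. -/
def perm6E : Equiv.Perm (Fin 24) :=
  c[4, 21, 14, 15, 13, 17] * c[7, 16, 11, 8, 12, 9] * c[0, 18, 22] * c[1, 6, 5] * c[2, 3]
    * c[10, 19]

/-- An element of `M₂₄` of cycle shape `1^6 3^6`. -/
def perm6G : Equiv.Perm (Fin 24) :=
  c[0, 22, 18] * c[1, 5, 6] * c[4, 14, 13] * c[7, 11, 12] * c[8, 9, 16] * c[15, 17, 21]

/-- An element of `M₂₄` of cycle shape `1^2 2^1 4^1 8^2`. -/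
def perm8E : Equiv.Perm (Fin 24) :=
  c[0, 3, 18, 10, 12, 15, 2, 20] * c[5, 13, 9, 16, 14, 19, 17, 7] * c[1, 6, 8, 22] * c[4, 21]

/-- An element of `M₂₄` of cycle shape `2^2 10^2`. -/
def perm10F : Equiv.Perm (Fin 24) :=
  c[1, 14, 4, 11, 6, 22, 18, 17, 2, 19] * c[5, 12, 20, 16, 7, 9, 21, 8, 10, 13] * c[0, 23]
    * c[3, 15]

theorem perm4C_mem : perm4C ∈ mathieu24 :=
  mem_mathieu24 _ ![3744, 2976, 3704, 2008, 3664, 32, 4048, 98, 50, 13, 49, 124]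
    (by decide +kernel)

theorem perm6E_mem : perm6E ∈ mathieu24 :=
  mem_mathieu24 _ ![3618, 62, 98, 2004, 1610, 448, 458, 37, 1573, 1024, 1488, 208]
    (by decide +kernel)

theorem perm6G_mem : perm6G ∈ mathieu24 :=
  mem_mathieu24 _ ![254, 2, 52, 50, 2032, 1994, 32, 3968, 3664, 1488, 1104, 1957]
    (by decide +kernel)

theorem perm8E_mem : perm8E ∈ mathieu24 :=
  mem_mathieu24 _ ![1226, 4079, 1962, 69, 1802, 128, 266, 392, 200, 52, 196, 496]
    (by decide +kernel)

theorem perm10F_mem : perm10F ∈ mathieu24 :=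
  mem_mathieu24 _ ![117, 469, 1925, 2031, 1991, 989, 1237, 3925, 2139, 3, 999, 797]
    (by decide +kernel)

/-- Representative of the class `4C`, of Frame shape `1^4 2^2 4^4`. -/
def rep4C : isometryGroup leechForm leech := leechPerm perm4C perm4C_mem

/-- Representative of the class `6E`, of Frame shape `1^2 2^2 3^2 6^2`. -/
def rep6E : isometryGroup leechForm leech := leechPerm perm6E perm6E_mem

/-- Representative of the class `6G`, of Frame shape `2^3 6^3`. The sign change inverts three of
the six fixed coordinates of `perm6G`, and an odd number of coordinates on three of its six
`3`-cycles. -/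
def rep6G : isometryGroup leechForm leech := leechSign * leechPerm perm6G perm6G_mem

/-- Representative of the class `8E`, of Frame shape `1^2 2^1 4^1 8^2`. -/
def rep8E : isometryGroup leechForm leech := leechPerm perm8E perm8E_mem

/-- Representative of the class `10F`, of Frame shape `2^2 10^2`. -/
def rep10F : isometryGroup leechForm leech := leechPerm perm10F perm10F_mem

/-! ## Root lattices of type `A` and the glue construction -/

/-- The simple root `α_{j+1} = e_j - e_{j+1}` of the root system of type `A_{k-1}`, inside
`ℚ^k` with coordinates numbered from `0`. -/
def simpleRoot (k : ℕ) (j : Fin (k - 1)) : Fin k → ℚ :=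
  Pi.single ⟨j, by omega⟩ 1 - Pi.single ⟨j + 1, by omega⟩ 1

/-- The fundamental weight `λ_j` of type `A_{k-1}`, for `1 ≤ j ≤ k - 1`:
`e_0 + ⋯ + e_{j-1} - (j / k) (1, …, 1)`. -/
def fundamentalWeight (k j : ℕ) : Fin k → ℚ :=
  fun a => (if (a : ℕ) < j then 1 else 0) - (j : ℚ) / k

/-- The fundamental weights are dual to the simple roots. -/
theorem fundamentalWeight_simpleRoot (k j : ℕ) (l : Fin (k - 1)) :
    stdForm (Fin k) (fundamentalWeight k j) (simpleRoot k l) = if j = l + 1 then 1 else 0 := by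
  change fundamentalWeight k j ⬝ᵥ simpleRoot k l = _
  simp only [simpleRoot, dotProduct_sub, dotProduct_single, fundamentalWeight]
  split_ifs <;> first | omega | norm_num

theorem fundamentalWeight_mem_span (k j : ℕ) (hj : j < k) :
    fundamentalWeight k j ∈ Submodule.span ℚ (Set.range (simpleRoot k)) := by
  have h0 : ∀ (a : ℕ) (ha : a < k), (Pi.single ⟨a, ha⟩ 1 - Pi.single ⟨0, by omega⟩ 1 : Fin k → ℚ) ∈
      Submodule.span ℚ (Set.range (simpleRoot k)) := by
    intro a
    induction a with
    | zero => intro ha; simp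
    | succ a ih =>
      intro ha
      have h := Submodule.sub_mem _ (ih (by omega))
        (Submodule.subset_span (R := ℚ) (s := Set.range (simpleRoot k)) ⟨⟨a, by omega⟩, rfl⟩)
      simpa [simpleRoot] using h
  have hsum : ∑ a, fundamentalWeight k j a = 0 := by
    have hk : (k : ℚ) ≠ 0 := by
      have : 0 < k := by omega
      positivity
    simp only [fundamentalWeight, Finset.sum_sub_distrib]
    rw [Fin.sum_univ_eq_sum_range (fun a => if a < j then (1 : ℚ) else 0) k, ← Finset.sum_filter]
    have : (Finset.range k).filter (fun a => a < j) = Finset.range j := by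
      ext a; simp; omega
    rw [this]
    simp
    field_simp
    simp
  have e : fundamentalWeight k j = ∑ a, fundamentalWeight k j a •
      (Pi.single a 1 - Pi.single ⟨0, by omega⟩ 1 : Fin k → ℚ) := by
    simp only [smul_sub, Finset.sum_sub_distrib]
    rw [← Finset.sum_smul, hsum, zero_smul, sub_zero]
    exact pi_eq_sum_univ' _
  rw [e]
  exact Submodule.sum_mem _ fun a _ => Submodule.smul_mem _ _ (h0 a a.2)

/-- The Weyl vector `ρ`, the sum of the fundamental weights. -/
def weylVector (k : ℕ) : Fin k → ℚ := ∑ j ∈ Finset.Icc 1 (k - 1), fundamentalWeight k j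

/-- The Coxeter element `r_{α_1} r_{α_2} ⋯ r_{α_{k-1}}` of type `A_{k-1}`. -/
def coxeterElement (k : ℕ) : Module.End ℚ (Fin k → ℚ) :=
  (List.ofFn fun j : Fin (k - 1) => rootReflection (stdForm (Fin k)) (simpleRoot k j)).prod

/-- A root lattice `R = A_{k_1 - 1} ⊕ ⋯ ⊕ A_{k_t - 1}` together with a glue vector
`c = (c_1, …, c_t)` in `R^*/R ≅ ⨁ ℤ/k_i` whose entries are units, represented by
`1 ≤ c_i < k_i`. -/
structure GlueDatum where
  t : ℕ
  k : Fin t → ℕ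
  c : Fin t → ℕ
  two_le : ∀ i, 2 ≤ k i
  one_le : ∀ i, 1 ≤ c i
  lt : ∀ i, c i < k i
  coprime : ∀ i, (c i).Coprime (k i)

namespace GlueDatum

variable (D : GlueDatum)

/-- The ambient space `⨁ ℚ^{k_i}`, which contains `ℚ ⊗ R`. -/
abbrev Space : Type := (i : Fin D.t) → Fin (D.k i) → ℚ

/-- The orthogonal sum of the standard forms. -/
def form : LinearMap.BilinForm ℚ D.Space :=
  ∑ i, (stdForm (Fin (D.k i))).compl₁₂ (LinearMap.proj i) (LinearMap.proj i)

/-- The root lattice `R`, spanned by the simple roots of all components. -/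
def R : Submodule ℤ D.Space :=
  Submodule.span ℤ {v | ∃ (i : Fin D.t) (j : Fin (D.k i - 1)), v = Pi.single i (simpleRoot _ j)}

/-- The dual lattice `R^*`. -/
abbrev Rdual : Submodule ℤ D.Space := dualLattice D.form D.R

/-- The discriminant group `R^*/R`. -/
abbrev Discr : Type := D.Rdual ⧸ D.R.submoduleOf D.Rdual

/-- The vector `χ_Δ = (ρ_1 / k_1, …, ρ_t / k_t)`. -/
def chi : D.Space := fun i => (1 / D.k i : ℚ) • weylVector (D.k i)

/-- The vector `λ_c = (λ_{c_1}, …, λ_{c_t})`. -/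
def weight : D.Space := fun i => fundamentalWeight (D.k i) (D.c i)

theorem form_apply (v w : D.Space) : D.form v w = ∑ i, v i ⬝ᵥ w i := by
  simp [form, stdForm, LinearMap.sum_apply, dotProductBilin]

theorem weight_mem : D.weight ∈ D.Rdual := by
  refine ⟨?_, ?_⟩
  · have hsum : D.weight = ∑ i, Pi.single i (fundamentalWeight (D.k i) (D.c i)) := by
      rw [Finset.univ_sum_single]
      rfl
    rw [hsum]
    refine Submodule.sum_mem _ fun i _ => ?_
    have hle : Submodule.span ℚ (Set.range (simpleRoot (D.k i))) ≤
        (Submodule.span ℚ (D.R : Set D.Space)).comap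
          (LinearMap.single ℚ (fun i => Fin (D.k i) → ℚ) i) := by
      refine Submodule.span_le.2 ?_
      rintro _ ⟨j, rfl⟩
      exact Submodule.subset_span (Submodule.subset_span ⟨i, j, rfl⟩)
    exact hle (fundamentalWeight_mem_span _ _ (D.lt i))
  · intro w hw
    induction hw using Submodule.span_induction with
    | mem x hx =>
      obtain ⟨i, j, rfl⟩ := hx
      refine ⟨if D.c i = j + 1 then 1 else 0, ?_⟩
      rw [form_apply, Finset.sum_eq_single i]
      · rw [Pi.single_eq_same]
        refine (fundamentalWeight_simpleRoot (D.k i) (D.c i) j).trans ?_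
        push_cast
        rfl
      · intro l _ hl
        rw [Pi.single_eq_of_ne hl, dotProduct_zero]
      · simp
    | zero => exact ⟨0, by simp⟩
    | add x y _ _ hx hy =>
      obtain ⟨m, hm⟩ := hx
      obtain ⟨n, hn⟩ := hy
      exact ⟨m + n, by rw [map_add, hm, hn, Int.cast_add]⟩
    | smul a x _ hx =>
      obtain ⟨m, hm⟩ := hx
      exact ⟨a * m, by rw [map_zsmul, hm, zsmul_eq_mul, Int.cast_mul]⟩

/-- The class of `λ_c` in `R^*/R`, which corresponds to `c ∈ ⨁ ℤ/k_i`. -/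
def glue : D.Discr := Submodule.Quotient.mk ⟨D.weight, D.weight_mem⟩

/-- The subgroup `C` of `R^*/R` generated by `c`. -/
def C : Submodule ℤ D.Discr := Submodule.span ℤ {D.glue}

/-- The lattice `L_A(C)`, the preimage of `C` in `R^*`. -/
def LA : Submodule ℤ D.Space :=
  (D.C.comap (D.R.submoduleOf D.Rdual).mkQ).map D.Rdual.subtype

/-- The lattice `L_B(C) = {v ∈ L_A(C) | (v | χ_Δ) ∈ ℤ}`. -/
def LB : Submodule ℤ D.Space where
  carrier := {v | v ∈ D.LA ∧ ∃ m : ℤ, D.form v D.chi = m}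
  zero_mem' := ⟨Submodule.zero_mem _, 0, by simp⟩
  add_mem' := by
    rintro a b ⟨ha, m, hm⟩ ⟨hb, n, hn⟩
    exact ⟨Submodule.add_mem _ ha hb, m + n, by simp [hm, hn]⟩
  smul_mem' := by
    rintro c a ⟨ha, m, hm⟩
    exact ⟨Submodule.smul_mem _ c ha, c * m, by
      rw [map_zsmul, LinearMap.smul_apply, hm, zsmul_eq_mul, Int.cast_mul]⟩

/-- The isometry `g_{Δ,c} = (g_{Δ_1}^{c_1}, …, g_{Δ_t}^{c_t})`, on the ambient space. -/
def coxeter : Module.End ℚ D.Space :=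
  LinearMap.pi fun i => (coxeterElement (D.k i) ^ D.c i) ∘ₗ LinearMap.proj i

end GlueDatum

/-- `R = A_3^4 A_1^2`, `c = (1 1 1 1 | 1 1)`. -/
def glue4C : GlueDatum :=
  ⟨6, ![4, 4, 4, 4, 2, 2], ![1, 1, 1, 1, 1, 1], by decide, by decide, by decide, by decide⟩

/-- `R = A_5^2 A_2^2 A_1^2`, `c = (1 1 | 1 1 | 1 1)`. -/
def glue6E : GlueDatum :=
  ⟨6, ![6, 6, 3, 3, 2, 2], ![1, 1, 1, 1, 1, 1], by decide, by decide, by decide, by decide⟩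

/-- `R = A_5^3 A_1^3`, `c = (1 1 1 | 1 1 1)`. -/
def glue6G : GlueDatum :=
  ⟨6, ![6, 6, 6, 2, 2, 2], ![1, 1, 1, 1, 1, 1], by decide, by decide, by decide, by decide⟩

/-- `R = A_7^2 A_3 A_1`, `c = (1 3 | 1 | 1)`. -/
def glue8E : GlueDatum :=
  ⟨4, ![8, 8, 4, 2], ![1, 3, 1, 1], by decide, by decide, by decide, by decide⟩

/-- `R = A_9^2 A_1^2`, `c = (1 3 | 1 1)`. -/
def glue10F : GlueDatum :=
  ⟨4, ![10, 10, 2, 2], ![1, 3, 1, 1], by decide, by decide, by decide, by decide⟩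

/-- The coinvariant lattice `Λ_g` is constructed as `L_B(C)` with `g` acting as `g_{Δ,c}`:
the lattice `L_A(C)` is even, and there is an isometry of `Λ_g` onto `L_B(C)` that carries the
action of `g` to the action of `g_{Δ,c}`. -/
def CoinvariantIsLB (g : isometryGroup leechForm leech) (D : GlueDatum) : Prop :=
  IsEvenLattice D.form D.LA ∧
  ∃ f : coinvariantLattice g ≃ₗ[ℤ] D.LB,
    (∀ x y : coinvariantLattice g,
      D.form (f x : D.Space) (f y : D.Space) =
        leechForm ((x : leech) : Fin 24 → ℚ) ((y : leech) : Fin 24 → ℚ)) ∧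
    ∀ x : coinvariantLattice g,
      (f (coinvariantRestrict g x) : D.Space) = D.coxeter (f x : D.Space)

/-! ## Membership in the Golay code and in the Leech lattice -/

/-! The property is invariant under conjugation (`CoinvariantIsLB.of_isConj`), so one representative
g per class suffices, and each acts as a monomial map x ↦ (s p · x (σ p)).

The Coxeter element of A_{k-1} permutes the k coordinates cyclically, so g_{Δ,c} shifts the
coordinates of component i by c_i. An equivariant isometry is therefore encoded by vectors U i a / d
in ℚ²⁴, the images of the unit vectors of ⨁ ℚ^{k_i}, which g must permute in the same way. The map
`analysis` pairs x with these vectors and `synthesis` forms their linear combinations. The two maps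
are adjoint, so they are inverse isometries once both compositions are the identity: U Uᵀ is a
multiple of the projection onto the vectors with sum zero in each component, and Uᵀ U agrees with a
multiple of the identity up to vectors fixed by g, which are invisible to Λ_g.

It remains to match the lattices. Membership in L_B(C) means that certain functionals take integral
values. On Λ_g each of them is the pairing with a vector of Λ (`W i a` or `X`), so integrality of Λ
gives `analysis_mem_LB`. Conversely, λ_c has norm 4 and (λ_c | χ_Δ) = 2, so L_B(C) is generated by
λ_c and the part of R with integral χ_Δ-value; explicit generators of that part, and λ_c, are sent
into Λ (`synthesis_mem_of_mem_LB`). Norm 4 also makes L_A(C) even.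

All conditions are finitely many integer identities and congruences, collected in
`IsometryCertificate` and evaluated by the kernel for each class. -/

/-- The coordinate functionals of the Golay code with respect to the rows of the generator
matrix, extended by zero outside the places `0, …, 11`. -/
def golayCoord (l : Fin 12) (q : Fin 24) : ZMod 2 :=
  if (![1, 2, 5, 10, 20, 41, 82, 164, 329, 659, 1319, 2639] l : ℕ).testBit q then 1 else 0

/-- The coefficients that express the complementary projection by parity checks. -/
def golayCocoord (l : Fin 12) (p : Fin 24) : ZMod 2 :=
  if (![13062144, 4845568, 1302528, 2605056, 5210112, 2031616, 4063232, 8126464,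
    7864320, 7340032, 6291456, 4194304] l : ℕ).testBit p then 1 else 0

/-- The identity of `𝔽₂²⁴` as a sum of a map into the Golay code and a combination of the parity
checks given by the rows of the generator matrix. -/
theorem golayRow_resolution (p q : Fin 24) :
    (if p = q then 1 else 0 : ZMod 2) = ∑ l, golayCoord l q * golayRow l p +
      ∑ l, golayCocoord l p * golayRow l q := by
  revert p q
  decide +kernel

/-- In the resolution of the identity the second sum consists of multiples of parity checks of y, so
it vanishes and the first sum exhibits y as a combination of rows. -/
theorem mem_golayCode_of_orthogonal {y : Fin 24 → ZMod 2}
    (h : ∀ l, ∑ p, golayRow l p * y p = 0) : y ∈ golayCode := by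
  have e : y = ∑ l, (∑ q, golayCoord l q * y q) • golayRow l := by
    funext p
    have h1 : y p = ∑ q, (if p = q then 1 else 0) * y q := by simp
    rw [h1]
    simp only [golayRow_resolution, add_mul, Finset.sum_add_distrib, Finset.sum_mul]
    rw [Finset.sum_comm, Finset.sum_comm (s := (Finset.univ : Finset (Fin 24)))]
    simp only [mul_assoc, ← Finset.mul_sum, h, mul_zero, Finset.sum_const_zero, add_zero,
      Finset.sum_apply, Pi.smul_apply, smul_eq_mul, Finset.sum_mul]
    refine Finset.sum_congr rfl fun l _ => Finset.sum_congr rfl fun q _ => ?_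
    ring
  rw [e]
  exact Submodule.sum_mem _ fun l _ => Submodule.smul_mem _ _ (Submodule.subset_span ⟨l, rfl⟩)

theorem golayRow_orthogonal (i j : Fin 12) : ∑ p, golayRow i p * golayRow j p = 0 := by
  revert i j
  decide +kernel

theorem golayCode_orthogonal {v w : Fin 24 → ZMod 2} (hv : v ∈ golayCode) (hw : w ∈ golayCode) :
    ∑ p, v p * w p = 0 := by
  induction hv using Submodule.span_induction with
  | mem x hx =>
    obtain ⟨i, rfl⟩ := hx
    induction hw using Submodule.span_induction with
    | mem y hy =>
      obtain ⟨j, rfl⟩ := hy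
      exact golayRow_orthogonal i j
    | zero => simp
    | add x y _ _ hx hy => simp [mul_add, Finset.sum_add_distrib, hx, hy]
    | smul a x _ hx =>
      simp only [Pi.smul_apply, smul_eq_mul, mul_left_comm _ a, ← Finset.mul_sum, hx, mul_zero]
  | zero => simp
  | add x y _ _ hx hy => simp [add_mul, Finset.sum_add_distrib, hx, hy]
  | smul a x _ hx =>
    simp only [Pi.smul_apply, smul_eq_mul, mul_assoc, ← Finset.mul_sum, hx, mul_zero]

/-- The congruences that characterize the integral vectors of the Leech lattice. -/
def LeechCongruences (z : Fin 24 → ℤ) : Prop :=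
  (∀ p, 2 ∣ z p - z 0) ∧ (∀ l, 4 ∣ ∑ p, if golayRow l p = 1 then z p else 0) ∧
    8 ∣ ∑ p, z p - 4 * z 0

instance (z : Fin 24 → ℤ) : Decidable (LeechCongruences z) := by
  unfold LeechCongruences; infer_instance

theorem golayRow_eq_zero_or_one (l : Fin 12) (p : Fin 24) :
    golayRow l p = 0 ∨ golayRow l p = 1 := by
  unfold golayRow; split_ifs <;> simp

theorem card_golayRow (l : Fin 12) : ∑ p, (if golayRow l p = 1 then (1 : ℤ) else 0) = 8 := by
  revert l
  decide +kernel

/-- Take m = z 0. Every row has weight 8, so the sum of z over a row is 8 z 0 + 2 ∑ y; divisibility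
by 4 says that y passes the parity check of that row. -/
theorem LeechCongruences.mem_leech {z : Fin 24 → ℤ} (h : LeechCongruences z) :
    (fun p => (z p : ℚ)) ∈ leech := by
  obtain ⟨h1, h2, h3⟩ := h
  choose y hy using h1
  have hz : ∀ p, z p = z 0 + 2 * y p := fun p => by linarith [hy p]
  refine ⟨z 0, y, fun p => congrArg (Int.cast : ℤ → ℚ) (hz p),
    mem_golayCode_of_orthogonal fun l => ?_, ?_⟩
  · obtain ⟨r, hr⟩ := h2 l
    have hsum : (∑ p, if golayRow l p = 1 then y p else 0) = 2 * (r - 2 * z 0) := by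
      have : ∑ p, (if golayRow l p = 1 then z p else 0) =
          z 0 * ∑ p, (if golayRow l p = 1 then (1 : ℤ) else 0) +
            2 * ∑ p, if golayRow l p = 1 then y p else 0 := by
        rw [Finset.mul_sum, Finset.mul_sum, ← Finset.sum_add_distrib]
        refine Finset.sum_congr rfl fun p _ => ?_
        rw [hz p]
        split_ifs <;> ring
      rw [card_golayRow] at this
      linarith
    have hc := congrArg (Int.cast : ℤ → ZMod 2) hsum
    have h20 : (2 : ZMod 2) = 0 := rfl
    push_cast at hc
    rw [h20, zero_mul] at hc
    rw [← hc]
    refine Finset.sum_congr rfl fun p _ => ?_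
    rcases golayRow_eq_zero_or_one l p with h | h <;> simp [h]
  · simp only [← hz]
    exact (Int.modEq_iff_dvd.2 h3).symm

theorem leechForm_apply (x y : Fin 24 → ℚ) : leechForm x y = 1 / 8 * ∑ p, x p * y p := rfl

/-- The Leech lattice is integral. -/
theorem leechForm_integral {x y : Fin 24 → ℚ} (hx : x ∈ leech) (hy : y ∈ leech) :
    ∃ r : ℤ, leechForm x y = r := by
  obtain ⟨m, a, h1, h2, h3⟩ := hx
  obtain ⟨n, b, k1, k2, k3⟩ := hy
  have ho := golayCode_orthogonal h2 k2
  have hc : ((∑ p, a p * b p : ℤ) : ZMod 2) = 0 := by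
    rw [← ho]; push_cast; rfl
  obtain ⟨r, hr⟩ := (ZMod.intCast_zmod_eq_zero_iff_dvd _ 2).1 hc
  obtain ⟨s, hs⟩ := Int.modEq_iff_dvd.1 h3
  obtain ⟨t, ht⟩ := Int.modEq_iff_dvd.1 k3
  push_cast at hr
  simp only [Finset.sum_add_distrib, ← Finset.mul_sum, Finset.sum_const, Finset.card_univ,
    Fintype.card_fin, nsmul_eq_mul] at hs ht
  -- The congruences give 2 ∑ a = -20 m - 8 s and 2 ∑ b = -20 n - 8 t, and orthogonality of
  -- codewords gives 4 ∑ a b = 8 r.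
  have key : ∑ p, (m + 2 * a p) * (n + 2 * b p) = 8 * (r - n * s - m * t - 2 * m * n) := by
    have e : ∀ p, (m + 2 * a p) * (n + 2 * b p) =
        m * n + 2 * m * b p + 2 * n * a p + 4 * (a p * b p) := fun p => by ring
    simp only [e, Finset.sum_add_distrib, ← Finset.mul_sum, Finset.sum_const, Finset.card_univ,
      Fintype.card_fin, nsmul_eq_mul, hr]
    push_cast at hs ht ⊢
    linear_combination (-n) * hs - m * ht
  refine ⟨r - n * s - m * t - 2 * m * n, ?_⟩
  rw [leechForm_apply]
  simp only [h1, k1]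
  have key' := congrArg (Int.cast : ℤ → ℚ) key
  push_cast at key' ⊢
  rw [key']
  ring

/-- Any integral vector fixed by a monomial map enters Λ^g after multiplication by 8, so no lattice
membership has to be checked for it. -/
theorem eight_smul_mem_leech (z : Fin 24 → ℤ) : (fun p => ((8 * z p : ℤ) : ℚ)) ∈ leech := by
  refine LeechCongruences.mem_leech ⟨fun p => ⟨4 * (z p - z 0), by ring⟩, fun l => ?_, ?_⟩
  · exact Finset.dvd_sum fun p _ => by
      split_ifs
      · exact ⟨2 * z p, by ring⟩
      · exact dvd_zero _
  · exact dvd_sub (Finset.dvd_sum fun p _ => ⟨z p, by ring⟩) ⟨4 * z 0, by ring⟩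

/-- A vector of the coinvariant lattice is orthogonal to every integral vector that is fixed by
the monomial map describing `g`. -/
theorem sum_mul_eq_zero_of_fixed {g : isometryGroup leechForm leech} {σ : Fin 24 → Fin 24}
    {s : Fin 24 → ℤ} (hg : ∀ (x : leech) p, (g.1 x : Fin 24 → ℚ) p = s p * (x : Fin 24 → ℚ) (σ p))
    {e : Fin 24 → ℤ} (he : ∀ p, e p = s p * e (σ p)) {x : leech} (hx : x ∈ coinvariantLattice g) :
    ∑ p, (e p : ℚ) * (x : Fin 24 → ℚ) p = 0 := by
  have h := hx ⟨_, eight_smul_mem_leech e⟩ (by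
    ext p
    rw [hg]
    change (s p : ℚ) * ((8 * e (σ p) : ℤ) : ℚ) = ((8 * e p : ℤ) : ℚ)
    rw [he p]
    push_cast
    ring)
  rw [leechForm_apply, Finset.mul_sum] at h
  rw [← h]
  refine Finset.sum_congr rfl fun p _ => ?_
  push_cast
  ring

/-! ## Isometries that are conjugate -/

/-- Conjugation by c carries the fixed vectors of g to those of c g c⁻¹, hence restricts to an
isometry of the coinvariant lattices that intertwines the two actions. -/
theorem CoinvariantIsLB.of_isConj {g h : isometryGroup leechForm leech} {D : GlueDatum}
    (hgh : IsConj g h) (hg : CoinvariantIsLB g D) : CoinvariantIsLB h D := by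
  obtain ⟨c, rfl⟩ := isConj_iff.1 hgh
  obtain ⟨hA, f, hf, hfg⟩ := hg
  have hc : ∀ z : leech, (c * g * c⁻¹).1 z = c.1 (g.1 (c.1.symm z)) := fun _ => rfl
  have h1 : ∀ x ∈ coinvariantLattice (c * g * c⁻¹), c.1.symm x ∈ coinvariantLattice g := by
    intro x hx w hw
    have := hx (c.1 w) (by rw [hc, LinearEquiv.symm_apply_apply, hw])
    rw [← c.2, LinearEquiv.apply_symm_apply]
    exact this
  have h2 : ∀ x ∈ coinvariantLattice g, c.1 x ∈ coinvariantLattice (c * g * c⁻¹) := by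
    intro x hx w hw
    have := hx (c.1.symm w) (by
      apply c.1.injective
      rw [LinearEquiv.apply_symm_apply, ← hc, hw])
    rw [← c.2, LinearEquiv.apply_symm_apply] at this
    exact this
  let E : coinvariantLattice (c * g * c⁻¹) ≃ₗ[ℤ] coinvariantLattice g :=
    { toFun := fun x => ⟨c.1.symm x, h1 x x.2⟩
      invFun := fun x => ⟨c.1 x, h2 x x.2⟩
      left_inv := fun x => by simp
      right_inv := fun x => by simp
      map_add' := fun x y => by ext; simp
      map_smul' := fun a x => by ext; simp }
  refine ⟨hA, E.trans f, fun x y => ?_, fun x => ?_⟩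
  · refine (hf _ _).trans ?_
    have := c.2 (c.1.symm x) (c.1.symm y)
    rw [LinearEquiv.apply_symm_apply, LinearEquiv.apply_symm_apply] at this
    exact this.symm
  · rw [LinearEquiv.trans_apply, LinearEquiv.trans_apply, ← hfg]
    congr 2
    ext1
    change c.1.symm (c.1 (g.1 (c.1.symm x))) = g.1 (c.1.symm x)
    rw [LinearEquiv.symm_apply_apply]

/-! ## Coxeter elements as permutations -/

/-- The permutation action on coordinates. -/
def permEnd (k : ℕ) : Equiv.Perm (Fin k) →* Module.End ℚ (Fin k → ℚ) where
  -- The inverse makes the map multiplicative; the unit vector e_a goes to e_{σ a}.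
  toFun σ := LinearMap.funLeft ℚ ℚ (σ⁻¹ : Equiv.Perm (Fin k))
  map_one' := by ext; simp [LinearMap.funLeft]
  map_mul' σ τ := by
    ext
    simp [LinearMap.funLeft]

theorem permEnd_apply (k : ℕ) (σ : Equiv.Perm (Fin k)) (v : Fin k → ℚ) (a : Fin k) :
    permEnd k σ v (σ a) = v a := by
  change v (σ⁻¹ (σ a)) = v a
  simp

/-- The product of transpositions that corresponds to the Coxeter element. -/
def coxeterPerm (k : ℕ) : Equiv.Perm (Fin k) :=
  (List.ofFn fun j : Fin (k - 1) =>
    Equiv.swap (⟨j, by omega⟩ : Fin k) ⟨j + 1, by omega⟩).prod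

theorem rootReflection_simpleRoot (k : ℕ) (j : Fin (k - 1)) :
    rootReflection (stdForm (Fin k)) (simpleRoot k j) =
      permEnd k (Equiv.swap (⟨j, by omega⟩ : Fin k) ⟨j + 1, by omega⟩) := by
  have hB : ∀ v w : Fin k → ℚ, stdForm (Fin k) v w = v ⬝ᵥ w := fun _ _ => rfl
  have hne : (⟨j, by omega⟩ : Fin k) ≠ ⟨j + 1, by omega⟩ := by simp [Fin.ext_iff]
  have h2 : stdForm (Fin k) (simpleRoot k j) (simpleRoot k j) = 2 := by
    simp only [hB, simpleRoot, dotProduct_sub, dotProduct_single]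
    simp [hne, hne.symm]
    norm_num
  refine LinearMap.ext fun v => funext fun a => ?_
  have h3 : stdForm (Fin k) v (simpleRoot k j) = v ⟨j, by omega⟩ - v ⟨j + 1, by omega⟩ := by
    simp [hB, simpleRoot, dotProduct_sub]
  have h4 : rootReflection (stdForm (Fin k)) (simpleRoot k j) v a =
      v a - (v ⟨j, by omega⟩ - v ⟨j + 1, by omega⟩) * simpleRoot k j a := by
    simp [rootReflection, h2, h3]
  rw [h4]
  change _ = v ((Equiv.swap (⟨j, by omega⟩ : Fin k) ⟨j + 1, by omega⟩)⁻¹ a)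
  rw [Equiv.swap_inv]
  rcases eq_or_ne a ⟨j, by omega⟩ with rfl | h
  · simp [simpleRoot, hne]
  rcases eq_or_ne a ⟨j + 1, by omega⟩ with rfl | h'
  · simp [simpleRoot, hne.symm]
  · rw [Equiv.swap_apply_of_ne_of_ne h h']
    simp [simpleRoot, h, h']

theorem coxeterElement_eq (k : ℕ) : coxeterElement k = permEnd k (coxeterPerm k) := by
  rw [coxeterElement, coxeterPerm, map_list_prod, List.map_ofFn]
  congr 2
  funext j
  exact rootReflection_simpleRoot k j

/-- Composed from right to left, the transpositions give the cycle a ↦ a + 1 mod k, so the power is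
the shift by c_i; certificates check this for the k_i that occur. -/
theorem GlueDatum.coxeter_apply (D : GlueDatum) (v : D.Space) (i : Fin D.t) (a : Fin (D.k i)) :
    D.coxeter v i ((coxeterPerm (D.k i) ^ D.c i) a) = v i a := by
  change (coxeterElement (D.k i) ^ D.c i) (v i) _ = v i a
  rw [coxeterElement_eq, ← map_pow, permEnd_apply]

/-! ## The lattices `R`, `L_A(C)` and `L_B(C)` in coordinates -/

namespace GlueDatum

variable (D : GlueDatum)

/-- The first index of a component. -/
def fst (i : Fin D.t) : Fin (D.k i) := ⟨0, by have := D.two_le i; omega⟩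

/-- The second index of a component. -/
def snd (i : Fin D.t) : Fin (D.k i) := ⟨1, by have := D.two_le i; omega⟩

theorem sum_simpleRoot (k : ℕ) (j : Fin (k - 1)) : ∑ a, simpleRoot k j a = 0 := by
  simp [simpleRoot, Finset.sum_sub_distrib]

theorem sum_eq_zero_of_mem_R {v : D.Space} (hv : v ∈ D.R) (i : Fin D.t) : ∑ a, v i a = 0 := by
  induction hv using Submodule.span_induction with
  | mem x hx =>
    obtain ⟨j, l, rfl⟩ := hx
    rcases eq_or_ne i j with rfl | h
    · rw [Pi.single_eq_same, sum_simpleRoot]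
    · simp [Pi.single_eq_of_ne h]
  | zero => simp
  | add x y _ _ hx hy => simp [Finset.sum_add_distrib, hx, hy]
  | smul a x _ hx => simp [← Finset.mul_sum, hx]

theorem integral_of_mem_R {v : D.Space} (hv : v ∈ D.R) (i : Fin D.t) (a : Fin (D.k i)) :
    ∃ m : ℤ, v i a = m := by
  induction hv using Submodule.span_induction with
  | mem x hx =>
    obtain ⟨j, l, rfl⟩ := hx
    rcases eq_or_ne i j with rfl | h
    · refine ⟨(Pi.single (⟨l, by omega⟩ : Fin (D.k i)) (1 : ℤ) : Fin (D.k i) → ℤ) a -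
        (Pi.single (⟨l + 1, by omega⟩ : Fin (D.k i)) (1 : ℤ) : Fin (D.k i) → ℤ) a, ?_⟩
      simp only [Pi.single_eq_same, simpleRoot, Pi.sub_apply, Pi.single_apply]
      push_cast
      rfl
    · exact ⟨0, by simp [Pi.single_eq_of_ne h]⟩
  | zero => exact ⟨0, by simp⟩
  | add x y _ _ hx hy =>
    obtain ⟨m, hm⟩ := hx
    obtain ⟨n, hn⟩ := hy
    exact ⟨m + n, by simp [hm, hn]⟩
  | smul c x _ hx =>
    obtain ⟨m, hm⟩ := hx
    exact ⟨c * m, by simp [hm]⟩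

theorem single_sub_single_mem_R (i : Fin D.t) (a : ℕ) (ha : a < D.k i) :
    (Pi.single i (Pi.single ⟨a, ha⟩ 1 - Pi.single (D.fst i) 1) : D.Space) ∈ D.R := by
  induction a with
  | zero => simp [fst]
  | succ a ih =>
    have h := D.R.sub_mem (ih (by omega)) (Submodule.subset_span ⟨i, ⟨a, by omega⟩, rfl⟩)
    rw [← Pi.single_sub] at h
    simpa [simpleRoot] using h

/-- The converse of `integral_of_mem_R` and `sum_eq_zero_of_mem_R`: relative to the vectors e_a -
e_0 the coefficients are the coordinates themselves. -/
theorem mem_R_of_integral {v : D.Space} (hv : ∀ i a, ∃ m : ℤ, v i a = m)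
    (hs : ∀ i, ∑ a, v i a = 0) : v ∈ D.R := by
  choose m hm using hv
  have e : v = ∑ i, ∑ a, m i a •
      (Pi.single i (Pi.single a 1 - Pi.single (D.fst i) 1) : D.Space) := by
    have h1 : ∀ i, v i = ∑ a, m i a • (Pi.single a 1 - Pi.single (D.fst i) 1) := by
      intro i
      funext b
      have h0 : ∑ a, (m i a : ℚ) = 0 := by rw [← hs i]; simp [hm]
      simp only [Finset.sum_apply, Pi.sub_apply, Pi.mul_apply, Pi.intCast_apply, zsmul_eq_mul,
        mul_sub, Finset.sum_sub_distrib]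
      rw [← Finset.sum_mul, h0, zero_mul, sub_zero, hm]
      simp [Pi.single_apply]
    funext i
    rw [Finset.sum_apply, Finset.sum_eq_single i]
    · rw [Finset.sum_apply, h1]
      simp
    · intro j _ hj
      rw [Finset.sum_apply]
      simp [Pi.single_eq_of_ne hj.symm]
    · simp
  rw [e]
  exact Submodule.sum_mem _ fun i _ => Submodule.sum_mem _ fun a _ =>
    Submodule.smul_mem _ _ (D.single_sub_single_mem_R i a a.2)

theorem form_integral_of_mem_R {v w : D.Space} (hv : v ∈ D.R) (hw : w ∈ D.R) :
    ∃ m : ℤ, D.form v w = m := by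
  choose a ha using D.integral_of_mem_R hv
  choose b hb using D.integral_of_mem_R hw
  refine ⟨∑ i, ∑ l, a i l * b i l, ?_⟩
  rw [form_apply]
  push_cast
  exact Finset.sum_congr rfl fun i _ => Finset.sum_congr rfl fun l _ => by rw [ha, hb]

/-- L_A(C) = R + ℤ λ_c; lying in R^* is automatic, because R is integral and λ_c lies in R^*. -/
theorem mem_LA_iff {v : D.Space} : v ∈ D.LA ↔ ∃ n : ℤ, v - n • D.weight ∈ D.R := by
  have key : ∀ (h : v ∈ D.Rdual), (D.R.submoduleOf D.Rdual).mkQ ⟨v, h⟩ ∈ D.C ↔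
      ∃ n : ℤ, v - n • D.weight ∈ D.R := by
    intro h
    rw [C, Submodule.mem_span_singleton]
    refine exists_congr fun n => ?_
    rw [eq_comm, glue, ← Submodule.Quotient.mk_smul, Submodule.mkQ_apply, Submodule.Quotient.eq]
    rfl
  constructor
  · rintro ⟨x, hx, rfl⟩
    exact (key x.2).1 hx
  · rintro ⟨n, hn⟩
    have h : v ∈ D.Rdual := by
      have h1 : v - n • D.weight ∈ D.Rdual :=
        ⟨Submodule.subset_span hn, fun w hw => D.form_integral_of_mem_R hn hw⟩
      have := D.Rdual.add_mem h1 (D.Rdual.smul_mem n D.weight_mem)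
      rwa [sub_add_cancel] at this
    exact ⟨⟨v, h⟩, (key h).2 ⟨n, hn⟩, rfl⟩

/-! ### Norms and pairings of fundamental weights and Weyl vectors -/

theorem sum_ite_val_lt (k c : ℕ) (hc : c ≤ k) (f : ℕ → ℚ) :
    ∑ a : Fin k, (if (a : ℕ) < c then f a else 0) = ∑ a ∈ Finset.range c, f a := by
  rw [Fin.sum_univ_eq_sum_range (fun a => if a < c then f a else 0) k, ← Finset.sum_filter]
  congr 1
  ext a
  simp
  omega

theorem sum_fundamentalWeight {k c : ℕ} (hk : 0 < k) (hc : c ≤ k) :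
    ∑ a, fundamentalWeight k c a = 0 := by
  have hk' : (k : ℚ) ≠ 0 := by positivity
  simp only [fundamentalWeight, Finset.sum_sub_distrib]
  rw [sum_ite_val_lt k c hc fun _ => 1]
  simp
  field_simp
  simp

theorem fundamentalWeight_dotProduct_self {k c : ℕ} (hk : 0 < k) (hc : c ≤ k) :
    fundamentalWeight k c ⬝ᵥ fundamentalWeight k c = c * (k - c) / k := by
  have hk' : (k : ℚ) ≠ 0 := by positivity
  -- With ε the indicator of a < c, the weight is λ = ε - c/k, and ε² = ε makes λ² linear in ε and
  -- λ.
  have e : fundamentalWeight k c ⬝ᵥ fundamentalWeight k c =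
      ∑ a : Fin k, ((if (a : ℕ) < c then (1 : ℚ) else 0) - c / k * fundamentalWeight k c a
        - c / k * (if (a : ℕ) < c then (1 : ℚ) else 0)) := by
    refine Finset.sum_congr rfl fun a _ => ?_
    simp only [fundamentalWeight]
    split_ifs <;> ring
  rw [e, Finset.sum_sub_distrib, Finset.sum_sub_distrib, ← Finset.mul_sum, ← Finset.mul_sum,
    sum_fundamentalWeight hk hc, sum_ite_val_lt k c hc fun _ => 1]
  simp
  field_simp

theorem sum_mul_fundamentalWeight {k c : ℕ} (hk : 0 < k) (hc : c ≤ k) :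
    ∑ a : Fin k, ((a : ℕ) : ℚ) * fundamentalWeight k c a = - (c * (k - c) / 2) := by
  have hk' : (k : ℚ) ≠ 0 := by positivity
  have hg : ∀ n : ℕ, ∑ a ∈ Finset.range n, (a : ℚ) = n * (n - 1) / 2 := by
    intro n
    induction n with
    | zero => simp
    | succ n ih => rw [Finset.sum_range_succ, ih]; push_cast; ring
  have e : ∀ a : Fin k, ((a : ℕ) : ℚ) * fundamentalWeight k c a =
      (if (a : ℕ) < c then ((a : ℕ) : ℚ) else 0) - c / k * ((a : ℕ) : ℚ) := by
    intro a
    simp only [fundamentalWeight]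
    split_ifs <;> ring
  simp only [e, Finset.sum_sub_distrib, ← Finset.mul_sum]
  rw [sum_ite_val_lt k c hc fun a => (a : ℚ), Fin.sum_univ_eq_sum_range (fun a => (a : ℚ)) k,
    hg, hg]
  field_simp
  ring

/-- The entries of ρ are a constant minus a, and the constant pairs to zero with v. -/
theorem dotProduct_weylVector {k : ℕ} {v : Fin k → ℚ} (hv : ∑ a, v a = 0) :
    v ⬝ᵥ weylVector k = - ∑ a : Fin k, ((a : ℕ) : ℚ) * v a := by
  have e : ∀ a : Fin k, weylVector k a =
      (k - 1 - ∑ j ∈ Finset.Icc 1 (k - 1), (j : ℚ) / k) - ((a : ℕ) : ℚ) := by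
    intro a
    have hcard : ∑ j ∈ Finset.Icc 1 (k - 1), (if (a : ℕ) < j then (1 : ℚ) else 0) =
        k - 1 - ((a : ℕ) : ℚ) := by
      rw [← Finset.sum_filter]
      have : (Finset.Icc 1 (k - 1)).filter (fun j => (a : ℕ) < j) =
          Finset.Ioc (a : ℕ) (k - 1) := by
        ext j; simp; omega
      have ha := a.2
      rw [this, Finset.sum_const, Nat.card_Ioc, nsmul_eq_mul, mul_one,
        Nat.cast_sub (by omega), Nat.cast_sub (by omega)]
      simp
    simp only [weylVector, Finset.sum_apply, fundamentalWeight, Finset.sum_sub_distrib, hcard]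
    ring
  generalize (k - 1 - ∑ j ∈ Finset.Icc 1 (k - 1), (j : ℚ) / k) = C at e
  simp only [dotProduct, e, mul_sub, Finset.sum_sub_distrib]
  rw [← Finset.sum_mul, hv]
  simp [mul_comm]

theorem form_chi {v : D.Space} (hv : ∀ i, ∑ a, v i a = 0) :
    D.form v D.chi = - ∑ i, ∑ a : Fin (D.k i), ((a : ℕ) : ℚ) / D.k i * v i a := by
  rw [form_apply, ← Finset.sum_neg_distrib]
  refine Finset.sum_congr rfl fun i _ => ?_
  rw [chi, dotProduct_smul, dotProduct_weylVector (hv i), smul_eq_mul, mul_neg, Finset.mul_sum]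
  congr 1
  exact Finset.sum_congr rfl fun a _ => by ring

theorem sum_weight (i : Fin D.t) : ∑ a, D.weight i a = 0 :=
  sum_fundamentalWeight (by have := D.two_le i; omega) (D.lt i).le

theorem form_weight_self : D.form D.weight D.weight =
    ∑ i, (D.c i * (D.k i - D.c i) / D.k i : ℚ) := by
  rw [form_apply]
  exact Finset.sum_congr rfl fun i _ =>
    fundamentalWeight_dotProduct_self (by have := D.two_le i; omega) (D.lt i).le

/-- Componentwise, (λ_c | ρ) / k = c (k - c) / (2 k). For norm 4 the pairing is 2, which places λ_c
in L_B(C). -/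
theorem form_weight_chi : D.form D.weight D.chi = D.form D.weight D.weight / 2 := by
  rw [form_chi _ D.sum_weight, form_weight_self, ← Finset.sum_neg_distrib, Finset.sum_div]
  refine Finset.sum_congr rfl fun i _ => ?_
  have h := sum_mul_fundamentalWeight (k := D.k i) (by have := D.two_le i; omega) (D.lt i).le
  have e : ∀ a : Fin (D.k i), ((a : ℕ) : ℚ) / D.k i * D.weight i a =
      1 / D.k i * (((a : ℕ) : ℚ) * fundamentalWeight (D.k i) (D.c i) a) := fun a => by
    rw [weight]; ring
  simp only [e, ← Finset.mul_sum, h]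
  ring

theorem form_comm (v w : D.Space) : D.form v w = D.form w v := by
  simp only [form_apply, dotProduct_comm]

/-- If the weight `λ_c` has norm `4` then `L_A(C)` is even. -/
theorem isEvenLattice_LA (h4 : D.form D.weight D.weight = 4) : IsEvenLattice D.form D.LA := by
  intro v hv
  obtain ⟨n, hn⟩ := D.mem_LA_iff.1 hv
  obtain ⟨m, hm⟩ := D.weight_mem.2 _ hn
  obtain ⟨r, hr⟩ : ∃ r : ℤ, D.form (v - n • D.weight) (v - n • D.weight) = 2 * r := by
    choose a ha using D.integral_of_mem_R hn
    -- R is even: modulo 2 a sum of squares equals the sum of the entries, which is zero.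
    have h2 : (2 : ℤ) ∣ ∑ i, ∑ l, a i l * a i l := by
      have h0 : ∀ i, ∑ l, a i l = 0 := by
        intro i
        have := D.sum_eq_zero_of_mem_R hn i
        simp only [ha] at this
        exact_mod_cast this
      refine Finset.dvd_sum fun i _ => ?_
      have : ∑ l, a i l * a i l = ∑ l, a i l * (a i l - 1) := by
        simp [mul_sub, Finset.sum_sub_distrib, h0]
      rw [this]
      exact Finset.dvd_sum fun l _ => (Int.even_mul_pred_self _).two_dvd
    obtain ⟨r, hr⟩ := h2
    refine ⟨r, ?_⟩
    have hr' := congrArg (Int.cast : ℤ → ℚ) hr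
    push_cast at hr'
    rw [← hr', form_apply]
    exact Finset.sum_congr rfl fun i _ => Finset.sum_congr rfl fun l _ => by rw [ha]
  refine ⟨r + n * m + 2 * n ^ 2, ?_⟩
  have e : v = (v - n • D.weight) + n • D.weight := by abel
  generalize v - n • D.weight = u at e hm hr
  rw [e]
  simp only [map_add, LinearMap.add_apply, map_zsmul, LinearMap.smul_apply, hr, h4, hm,
    D.form_comm u D.weight]
  simp only [zsmul_eq_mul]
  push_cast
  ring

end GlueDatum

/-! ## Certificates for equivariant isometries -/

/-- The vector `e` is fixed by the monomial map `x ↦ (s p * x (σ p))`. -/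
def FixedByMonomial (σ : Fin 24 → Fin 24) (s e : Fin 24 → ℤ) : Prop :=
  ∀ p, e p = s p * e (σ p)

instance (σ : Fin 24 → Fin 24) (s e : Fin 24 → ℤ) : Decidable (FixedByMonomial σ s e) := by
  unfold FixedByMonomial; infer_instance

/-- The vector `z / d` is integral and belongs to the Leech lattice. -/
def LeechMultiple (d : ℤ) (z : Fin 24 → ℤ) : Prop :=
  (∀ p, d ∣ z p) ∧ LeechCongruences fun p => z p / d

instance (d : ℤ) (z : Fin 24 → ℤ) : Decidable (LeechMultiple d z) := by
  unfold LeechMultiple; infer_instance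

theorem LeechMultiple.mem_leech {d : ℤ} {z : Fin 24 → ℤ} (h : LeechMultiple d z) (hd : d ≠ 0) :
    (fun p => (1 / d * z p : ℚ)) ∈ leech := by
  convert h.2.mem_leech using 2 with p
  rw [Int.cast_div (h.1 p) (by exact_mod_cast hd)]
  ring

namespace GlueDatum

variable (D : GlueDatum)

/-- The shift by `c_i` of the coordinates of the `i`-th component. -/
def shift (i : Fin D.t) (a : Fin (D.k i)) : Fin (D.k i) :=
  ⟨(a + D.c i) % D.k i, Nat.mod_lt _ (by have := D.two_le i; omega)⟩

/-- The quotient `k_j / k_i`. -/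
def ratio (j i : Fin D.t) : ℕ := D.k j / D.k i

/-- Integral data for an equivariant isometry of the coinvariant lattice of the monomial map
`x ↦ (s p * x (σ p))` onto `L_B(C)`. The vectors `U i a / d` are the images of the unit vectors of
the ambient space of `L_B(C)` under the inverse map; the vectors `W i a` and `X` of the Leech
lattice represent functionals that detect `L_B(C)`. -/
structure IsometryCertificate (σ : Fin 24 → Fin 24) (s : Fin 24 → ℤ) (d : ℤ) (i₀ : Fin D.t)
    (U W : ∀ i, Fin (D.k i) → Fin 24 → ℤ) (X : Fin 24 → ℤ) : Prop where
  injective : Function.Injective σ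
  d_ne : d ≠ 0
  -- With c_{i₀} = 1 and all k_i dividing k_{i₀}, the component i₀ alone determines the multiple of
  -- λ_c modulo R.
  c_eq : D.c i₀ = 1
  dvd : ∀ i, D.k i ∣ D.k i₀
  -- The norm of λ_c is 4, multiplied by k_{i₀} to stay in ℤ.
  norm : ∑ i, (D.c i * (D.k i - D.c i) * D.ratio i₀ i : ℤ) = 4 * D.k i₀
  coxeter : ∀ i a, (coxeterPerm (D.k i) ^ D.c i) a = D.shift i a
  transitive : ∀ i (a : Fin (D.k i)), ∃ m : Fin (D.k i), (D.shift i)^[m] (D.fst i) = a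
  sum_U : ∀ i p, ∑ a, U i a p = 0
  equivariant : ∀ i a p, U i (D.shift i a) p * s p = U i a (σ p)
  -- Uᵀ U need not be a multiple of the identity: an error fixed by g pairs to zero with Λ_g.
  -- `W_fixed` and `X_fixed` allow the same freedom.
  left_inv : ∀ p, FixedByMonomial σ s fun q =>
    8 * d ^ 2 * (if p = q then 1 else 0) - ∑ i, ∑ a, U i a p * U i a q
  right_inv_ne : ∀ i j, i ≠ j → ∀ a b, ∑ p, U i a p * U j b p = 0
  right_inv : ∀ i a b, D.k i * ∑ p, U i a p * U i b p =
    8 * d ^ 2 * (D.k i * (if a = b then 1 else 0) - 1)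
  W_mem : ∀ i a, LeechCongruences (W i a)
  W_fixed : ∀ i a, FixedByMonomial σ s fun p =>
    d * W i a p - (U i a p - D.c i * D.ratio i₀ i * U i₀ (D.fst i₀) p)
  X_mem : LeechCongruences X
  X_fixed : FixedByMonomial σ s fun p =>
    D.k i₀ * d * X p + ∑ i, ∑ a : Fin (D.k i), (D.ratio i₀ i * (a : ℕ) : ℤ) * U i a p
  -- Since (e_a - e_0 | χ_Δ) = -a / k_i, subtracting a k_{i₀} / k_i copies of e_1 - e_0 in component
  -- i₀ kills the χ_Δ-value; k_{i₀} copies of the latter have value -1. Together these generate the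
  -- part of R with integral χ_Δ-value.
  gen_mem : ∀ i a, LeechMultiple d fun p => U i a p - U i (D.fst i) p -
    (a : ℕ) * D.ratio i₀ i * (U i₀ (D.snd i₀) p - U i₀ (D.fst i₀) p)
  root_mem : LeechMultiple d fun p => D.k i₀ * (U i₀ (D.snd i₀) p - U i₀ (D.fst i₀) p)
  weight_mem : LeechMultiple d fun p =>
    ∑ i, ∑ a : Fin (D.k i), if (a : ℕ) < D.c i then U i a p else 0

/-! ### The adjoint maps and the equivariant isometry of rational spaces -/

/-- The linear map `ℚ²⁴ → ⨁ ℚ^{k_i}` with matrix `U / (8 d)`. -/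
def analysis (d : ℤ) (U : ∀ i, Fin (D.k i) → Fin 24 → ℤ) : (Fin 24 → ℚ) →ₗ[ℚ] D.Space where
  toFun x i a := 1 / (8 * d) * ∑ p, U i a p * x p
  map_add' x y := by
    funext i a
    simp [mul_add, Finset.sum_add_distrib]
  map_smul' r x := by
    funext i a
    simp only [Pi.smul_apply, smul_eq_mul, RingHom.id_apply, Finset.mul_sum]
    exact Finset.sum_congr rfl fun p _ => by ring

/-- The linear map `⨁ ℚ^{k_i} → ℚ²⁴` with matrix `Uᵀ / d`. -/
def synthesis (d : ℤ) (U : ∀ i, Fin (D.k i) → Fin 24 → ℤ) : D.Space →ₗ[ℚ] (Fin 24 → ℚ) where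
  toFun v p := 1 / d * ∑ i, ∑ a, U i a p * v i a
  map_add' v w := by
    funext p
    simp [mul_add, Finset.sum_add_distrib]
  map_smul' r v := by
    funext p
    simp only [Pi.smul_apply, smul_eq_mul, RingHom.id_apply, Finset.mul_sum]
    exact Finset.sum_congr rfl fun i _ => Finset.sum_congr rfl fun a _ => by ring

/-- Adjointness; the factor 1/8 in the Leech form accounts for the different normalisations 1/(8 d)
and 1/d. -/
theorem leechForm_synthesis (d : ℤ) (U : ∀ i, Fin (D.k i) → Fin 24 → ℤ) (v : D.Space)
    (x : Fin 24 → ℚ) : leechForm (D.synthesis d U v) x = D.form v (D.analysis d U x) := by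
  rw [leechForm_apply, form_apply]
  simp only [synthesis, analysis, LinearMap.coe_mk, AddHom.coe_mk, dotProduct, Finset.mul_sum,
    Finset.sum_mul]
  rw [Finset.sum_comm]
  refine Finset.sum_congr rfl fun i _ => ?_
  rw [Finset.sum_comm]
  refine Finset.sum_congr rfl fun a _ => Finset.sum_congr rfl fun p _ => ?_
  have : (1 / (8 * d) : ℚ) = 1 / 8 * (1 / d) := by rw [div_mul_div_comm, one_mul]
  rw [this]
  ring

variable {D} {σ : Fin 24 → Fin 24} {s : Fin 24 → ℤ} {d : ℤ} {i₀ : Fin D.t}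
  {U W : ∀ i, Fin (D.k i) → Fin 24 → ℤ} {X : Fin 24 → ℤ}

namespace IsometryCertificate

theorem k_ne_zero (i : Fin D.t) : (D.k i : ℚ) ≠ 0 := by
  have := D.two_le i
  have h : 0 < D.k i := by omega
  positivity

theorem cast_div (h : D.IsometryCertificate σ s d i₀ U W X) (i : Fin D.t) :
    (D.ratio i₀ i : ℚ) = D.k i₀ / D.k i :=
  Nat.cast_div (h.dvd i) (k_ne_zero i)

theorem cast_d_ne (h : D.IsometryCertificate σ s d i₀ U W X) : (d : ℚ) ≠ 0 :=
  by exact_mod_cast h.d_ne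

theorem form_weight (h : D.IsometryCertificate σ s d i₀ U W X) :
    D.form D.weight D.weight = 4 := by
  have h1 := congrArg (Int.cast : ℤ → ℚ) h.norm
  push_cast at h1
  have h2 : ∀ i, (D.c i * (D.k i - D.c i) * D.ratio i₀ i : ℚ) =
      D.k i₀ * (D.c i * (D.k i - D.c i) / D.k i) := fun i => by
    rw [h.cast_div]; ring
  rw [Finset.sum_congr rfl fun i _ => h2 i, ← Finset.mul_sum, mul_comm 4] at h1
  rw [form_weight_self]
  exact mul_left_cancel₀ (k_ne_zero i₀) h1

theorem sum_analysis (h : D.IsometryCertificate σ s d i₀ U W X) (x : Fin 24 → ℚ) (i : Fin D.t) :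
    ∑ a, D.analysis d U x i a = 0 := by
  simp only [analysis, LinearMap.coe_mk, AddHom.coe_mk, ← Finset.mul_sum]
  rw [Finset.sum_comm]
  have : ∀ p, ∑ a, (U i a p : ℚ) = 0 := fun p => by exact_mod_cast h.sum_U i p
  simp [← Finset.sum_mul, this]

theorem analysis_synthesis (h : D.IsometryCertificate σ s d i₀ U W X) {v : D.Space}
    (hv : ∀ i, ∑ a, v i a = 0) : D.analysis d U (D.synthesis d U v) = v := by
  have hd := h.cast_d_ne
  funext i a
  have e : D.analysis d U (D.synthesis d U v) i a =
      1 / (8 * d ^ 2) * ∑ j, ∑ b, (∑ p, (U i a p : ℚ) * U j b p) * v j b := by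
    simp only [analysis, synthesis, LinearMap.coe_mk, AddHom.coe_mk, Finset.mul_sum,
      Finset.sum_mul]
    rw [Finset.sum_comm]
    refine Finset.sum_congr rfl fun j _ => ?_
    rw [Finset.sum_comm]
    refine Finset.sum_congr rfl fun b _ => Finset.sum_congr rfl fun p _ => ?_
    field_simp
  rw [e, Finset.sum_eq_single i]
  · have h1 : ∀ b, ∑ p, (U i a p : ℚ) * U i b p =
        8 * d ^ 2 * ((if a = b then 1 else 0) - 1 / D.k i) := by
      intro b
      have := congrArg (Int.cast : ℤ → ℚ) (h.right_inv i a b)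
      push_cast at this
      have hk := k_ne_zero i
      apply mul_left_cancel₀ hk
      rw [this]
      field_simp
    simp only [h1, mul_assoc, sub_mul, ← Finset.mul_sum, Finset.sum_sub_distrib, hv]
    simp
    field_simp
  · intro j _ hj
    have h1 : ∀ b, ∑ p, (U i a p : ℚ) * U j b p = 0 := fun b => by
      exact_mod_cast h.right_inv_ne i j hj.symm a b
    simp [h1]
  · simp

variable {g : isometryGroup leechForm leech}

theorem synthesis_analysis (h : D.IsometryCertificate σ s d i₀ U W X)
    (hg : ∀ (x : leech) p, (g.1 x : Fin 24 → ℚ) p = s p * (x : Fin 24 → ℚ) (σ p))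
    {x : leech} (hx : x ∈ coinvariantLattice g) :
    D.synthesis d U (D.analysis d U x) = x := by
  have hd := h.cast_d_ne
  funext p
  have h1 := sum_mul_eq_zero_of_fixed hg (h.left_inv p) hx
  have e : D.synthesis d U (D.analysis d U x) p =
      1 / (8 * d ^ 2) * ∑ q, (∑ i, ∑ a, (U i a p : ℚ) * U i a q) * (x : Fin 24 → ℚ) q := by
    simp only [analysis, synthesis, LinearMap.coe_mk, AddHom.coe_mk, Finset.mul_sum,
      Finset.sum_mul]
    symm
    rw [Finset.sum_comm]
    refine Finset.sum_congr rfl fun i _ => ?_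
    rw [Finset.sum_comm]
    refine Finset.sum_congr rfl fun a _ => Finset.sum_congr rfl fun q _ => ?_
    field_simp
  rw [e]
  push_cast at h1
  simp only [sub_mul, Finset.sum_sub_distrib] at h1
  rw [← sub_eq_zero.1 h1]
  simp
  field_simp

theorem analysis_apply_map (h : D.IsometryCertificate σ s d i₀ U W X)
    (hg : ∀ (x : leech) p, (g.1 x : Fin 24 → ℚ) p = s p * (x : Fin 24 → ℚ) (σ p)) (x : leech)
    (i : Fin D.t) (a : Fin (D.k i)) :
    D.analysis d U (g.1 x : leech) i (D.shift i a) = D.analysis d U x i a := by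
  have hσ : Function.Bijective σ := Finite.injective_iff_bijective.1 h.injective
  simp only [analysis, LinearMap.coe_mk, AddHom.coe_mk, hg]
  congr 1
  rw [← hσ.sum_comp (fun p => (U i a p : ℚ) * (x : Fin 24 → ℚ) p)]
  refine Finset.sum_congr rfl fun p _ => ?_
  rw [← h.equivariant i a p]
  push_cast
  ring

theorem analysis_map (h : D.IsometryCertificate σ s d i₀ U W X)
    (hg : ∀ (x : leech) p, (g.1 x : Fin 24 → ℚ) p = s p * (x : Fin 24 → ℚ) (σ p)) (x : leech) :
    D.analysis d U (g.1 x : leech) = D.coxeter (D.analysis d U x) := by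
  funext i a
  obtain ⟨b, rfl⟩ := (coxeterPerm (D.k i) ^ D.c i).surjective a
  rw [coxeter_apply, h.coxeter, h.analysis_apply_map hg]

/-- For fixed w, `analysis` of w is invariant under the shifts, hence constant on each component by
transitivity, and so orthogonal to sum-zero vectors. -/
theorem synthesis_orthogonal (h : D.IsometryCertificate σ s d i₀ U W X)
    (hg : ∀ (x : leech) p, (g.1 x : Fin 24 → ℚ) p = s p * (x : Fin 24 → ℚ) (σ p)) {v : D.Space}
    (hv : ∀ i, ∑ a, v i a = 0) {w : leech} (hw : g.1 w = w) :
    leechForm (D.synthesis d U v) w = 0 := by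
  have hs : ∀ i a, D.analysis d U w i (D.shift i a) = D.analysis d U w i a := fun i a => by
    have := h.analysis_apply_map hg w i a
    rwa [hw] at this
  have hc : ∀ i a, D.analysis d U w i a = D.analysis d U w i (D.fst i) := by
    intro i a
    obtain ⟨m, rfl⟩ := h.transitive i a
    generalize (m : ℕ) = n
    induction n with
    | zero => rfl
    | succ n ih => rw [Function.iterate_succ_apply', hs, ih]
  rw [leechForm_synthesis, form_apply]
  refine Finset.sum_eq_zero fun i _ => ?_
  simp only [dotProduct]
  rw [Finset.sum_congr rfl fun a _ => congrArg (v i a * ·) (hc i a), ← Finset.sum_mul, hv,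
    zero_mul]

/-! ### Integrality: Λ_g is mapped into L_B(C) -/

theorem analysis_eq_pairing (h : D.IsometryCertificate σ s d i₀ U W X)
    (hg : ∀ (x : leech) p, (g.1 x : Fin 24 → ℚ) p = s p * (x : Fin 24 → ℚ) (σ p))
    {x : leech} (hx : x ∈ coinvariantLattice g) (i : Fin D.t) (a : Fin (D.k i)) :
    D.analysis d U x i a - D.c i * (D.k i₀ / D.k i : ℚ) * D.analysis d U x i₀ (D.fst i₀) =
      leechForm (fun p => (W i a p : ℚ)) x := by
  have hd := h.cast_d_ne
  have h1 := sum_mul_eq_zero_of_fixed hg (h.W_fixed i a) hx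
  push_cast at h1
  simp only [sub_mul, mul_assoc, Finset.sum_sub_distrib, ← Finset.mul_sum] at h1
  rw [← mul_assoc (D.c i : ℚ), h.cast_div] at h1
  rw [leechForm_apply]
  simp only [analysis, LinearMap.coe_mk, AddHom.coe_mk]
  generalize ∑ p, (U i a p : ℚ) * (x : Fin 24 → ℚ) p = A at *
  generalize ∑ p, (U i₀ (D.fst i₀) p : ℚ) * (x : Fin 24 → ℚ) p = B at *
  generalize ∑ p, (W i a p : ℚ) * (x : Fin 24 → ℚ) p = E at *
  generalize (D.c i : ℚ) * (D.k i₀ / D.k i : ℚ) = K at *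
  field_simp
  linear_combination -h1

theorem form_analysis_chi (h : D.IsometryCertificate σ s d i₀ U W X)
    (hg : ∀ (x : leech) p, (g.1 x : Fin 24 → ℚ) p = s p * (x : Fin 24 → ℚ) (σ p))
    {x : leech} (hx : x ∈ coinvariantLattice g) :
    D.form (D.analysis d U x) D.chi = leechForm (fun p => (X p : ℚ)) x := by
  have hd := h.cast_d_ne
  have h1 := sum_mul_eq_zero_of_fixed hg h.X_fixed hx
  push_cast at h1
  simp only [add_mul, mul_assoc, Finset.sum_add_distrib, ← Finset.mul_sum, Finset.sum_mul] at h1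
  rw [Finset.sum_comm] at h1
  rw [form_chi _ (h.sum_analysis _), leechForm_apply]
  have h2 : ∑ i, ∑ q, (D.ratio i₀ i : ℚ) *
      ∑ a : Fin (D.k i), ((a : ℕ) : ℚ) * ((U i a q : ℚ) * (x : Fin 24 → ℚ) q) =
      D.k i₀ * (8 * d) * ∑ i, ∑ a : Fin (D.k i), ((a : ℕ) : ℚ) / D.k i *
        D.analysis d U x i a := by
    rw [Finset.mul_sum]
    refine Finset.sum_congr rfl fun i _ => ?_
    rw [← Finset.mul_sum, Finset.sum_comm, Finset.mul_sum, Finset.mul_sum]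
    refine Finset.sum_congr rfl fun a _ => ?_
    simp only [analysis, LinearMap.coe_mk, AddHom.coe_mk, ← Finset.mul_sum]
    rw [h.cast_div]
    field_simp
  rw [h2] at h1
  have hk := k_ne_zero i₀
  have hc : (D.k i₀ * (8 * d) : ℚ) ≠ 0 := by positivity
  apply mul_left_cancel₀ hc
  linear_combination -h1

theorem analysis_mem_LB (h : D.IsometryCertificate σ s d i₀ U W X)
    (hg : ∀ (x : leech) p, (g.1 x : Fin 24 → ℚ) p = s p * (x : Fin 24 → ℚ) (σ p))
    {x : leech} (hx : x ∈ coinvariantLattice g) : D.analysis d U x ∈ D.LB := by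
  have hm : ∀ i a, ∃ m : ℤ, D.analysis d U x i a -
      D.c i * (D.k i₀ / D.k i : ℚ) * D.analysis d U x i₀ (D.fst i₀) = m := fun i a => by
    rw [h.analysis_eq_pairing hg hx]
    exact leechForm_integral (h.W_mem i a).mem_leech x.2
  have hs := h.sum_analysis (x : Fin 24 → ℚ)
  refine ⟨?_, by
    rw [h.form_analysis_chi hg hx]
    exact leechForm_integral h.X_mem.mem_leech x.2⟩
  generalize D.analysis d U x = v at *
  choose m hm using hm
  -- Summing the integers m i₀ a over a leaves only -k_{i₀} v_{i₀}(0). This integer is the multiple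
  -- n of λ_c to subtract, since λ_c has entry -c_i / k_i modulo ℤ.
  have hn : -(D.k i₀ * v i₀ (D.fst i₀)) = (∑ a, m i₀ a : ℤ) := by
    push_cast
    simp only [← hm, Finset.sum_sub_distrib, hs, h.c_eq]
    simp [k_ne_zero i₀]
  rw [mem_LA_iff]
  refine ⟨∑ a, m i₀ a, D.mem_R_of_integral (fun i a => ?_) fun i => ?_⟩
  · generalize ∑ a, m i₀ a = n at hn
    refine ⟨m i a - n * (if (a : ℕ) < D.c i then 1 else 0), ?_⟩
    have hk := k_ne_zero i
    have h1 := hm i a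
    push_cast
    rw [← h1, ← hn]
    simp only [Pi.sub_apply, Pi.smul_apply]
    simp only [weight, fundamentalWeight, zsmul_eq_mul, ← hn]
    field_simp
    ring
  · simp only [Pi.sub_apply, Pi.smul_apply, Finset.sum_sub_distrib, hs, ← Finset.smul_sum,
      D.sum_weight, smul_zero, sub_zero]

theorem sum_eq_zero_of_mem_LA {v : D.Space} (hv : v ∈ D.LA) (i : Fin D.t) : ∑ a, v i a = 0 := by
  obtain ⟨n, hn⟩ := D.mem_LA_iff.1 hv
  have := D.sum_eq_zero_of_mem_R hn i
  simpa [Finset.sum_sub_distrib, ← Finset.mul_sum, D.sum_weight] using this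

/-! ### Integrality: L_B(C) is mapped into Λ -/

theorem synthesis_weight_mem (h : D.IsometryCertificate σ s d i₀ U W X) :
    D.synthesis d U D.weight ∈ leech := by
  convert h.weight_mem.mem_leech h.d_ne using 1
  funext p
  simp only [synthesis, LinearMap.coe_mk, AddHom.coe_mk, weight, fundamentalWeight]
  congr 1
  push_cast
  refine Finset.sum_congr rfl fun i _ => ?_
  have : ∑ a, (U i a p : ℚ) = 0 := by exact_mod_cast h.sum_U i p
  simp only [mul_sub, Finset.sum_sub_distrib, ← Finset.sum_mul, this, zero_mul, sub_zero]
  exact Finset.sum_congr rfl fun a _ => by split_ifs <;> simp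

theorem synthesis_mem_of_mem_R (h : D.IsometryCertificate σ s d i₀ U W X) {v : D.Space}
    (hv : v ∈ D.R) (hχ : ∃ m : ℤ, D.form v D.chi = m) : D.synthesis d U v ∈ leech := by
  obtain ⟨m, hm⟩ := hχ
  have hs := D.sum_eq_zero_of_mem_R hv
  choose r hr using D.integral_of_mem_R hv
  rw [form_chi _ hs] at hm
  -- Expand v in the vectors e_a - e_0 and replace each by its corrected generator. The corrections
  -- add up to k_{i₀} ∑ (a / k_i) v_i(a) = -m k_{i₀} copies of e_1 - e_0 in component i₀.
  have e : D.synthesis d U v =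
      ∑ i, ∑ a, r i a • (fun p => (1 / d * ((U i a p - U i (D.fst i) p - (a : ℕ) *
        D.ratio i₀ i * (U i₀ (D.snd i₀) p - U i₀ (D.fst i₀) p) : ℤ) : ℚ) : ℚ)) +
      (-m) • fun p => (1 / d * ((D.k i₀ * (U i₀ (D.snd i₀) p - U i₀ (D.fst i₀) p) : ℤ) : ℚ) :
        ℚ) := by
    funext p
    simp only [synthesis, LinearMap.coe_mk, AddHom.coe_mk, Pi.add_apply, Finset.sum_apply,
      Pi.smul_apply]
    simp only [zsmul_eq_mul]
    push_cast
    simp only [← hr, ← hm, h.cast_div, neg_neg, Finset.sum_mul, Finset.mul_sum,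
      ← Finset.sum_add_distrib]
    refine Finset.sum_congr rfl fun i _ => ?_
    have h1 : ∀ a, v i a * (1 / d * ((U i a p : ℚ) - U i (D.fst i) p - (a : ℕ) *
        (D.k i₀ / D.k i) * (U i₀ (D.snd i₀) p - U i₀ (D.fst i₀) p))) +
        ((a : ℕ) : ℚ) / D.k i * v i a *
          (1 / d * (D.k i₀ * ((U i₀ (D.snd i₀) p : ℚ) - U i₀ (D.fst i₀) p))) =
        1 / d * (U i a p * v i a) - v i a * (1 / d * U i (D.fst i) p) := fun a => by ring
    simp only [h1, Finset.sum_sub_distrib, ← Finset.sum_mul, hs, zero_mul, sub_zero]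
  rw [e]
  refine leech.add_mem (Submodule.sum_mem _ fun i _ => Submodule.sum_mem _ fun a _ =>
    leech.smul_mem _ ((h.gen_mem i a).mem_leech h.d_ne)) (leech.smul_mem _ ?_)
  exact h.root_mem.mem_leech h.d_ne

theorem synthesis_mem_of_mem_LB (h : D.IsometryCertificate σ s d i₀ U W X) {v : D.Space}
    (hv : v ∈ D.LB) : D.synthesis d U v ∈ leech := by
  obtain ⟨hA, m, hm⟩ := hv
  obtain ⟨n, hn⟩ := D.mem_LA_iff.1 hA
  -- Removing n λ_c lowers the χ_Δ-value by 2 n, so it stays integral.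
  have h1 := h.synthesis_mem_of_mem_R hn ⟨m - 2 * n, by
    rw [map_sub, LinearMap.sub_apply, map_zsmul, LinearMap.smul_apply, hm, form_weight_chi,
      h.form_weight, zsmul_eq_mul]
    push_cast
    ring⟩
  have h2 := leech.add_mem h1 (leech.smul_mem n h.synthesis_weight_mem)
  rwa [map_sub, map_zsmul, sub_add_cancel] at h2

theorem coinvariantIsLB (h : D.IsometryCertificate σ s d i₀ U W X)
    (hg : ∀ (x : leech) p, (g.1 x : Fin 24 → ℚ) p = s p * (x : Fin 24 → ℚ) (σ p)) :
    CoinvariantIsLB g D := by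
  let f : coinvariantLattice g ≃ₗ[ℤ] D.LB :=
    { toFun := fun x => ⟨D.analysis d U (x : leech), h.analysis_mem_LB hg x.2⟩
      invFun := fun v => ⟨⟨D.synthesis d U v, h.synthesis_mem_of_mem_LB v.2⟩, fun w hw =>
        h.synthesis_orthogonal hg (sum_eq_zero_of_mem_LA v.2.1) hw⟩
      left_inv := fun x => Subtype.ext (Subtype.ext (h.synthesis_analysis hg x.2))
      right_inv := fun v => Subtype.ext (h.analysis_synthesis (sum_eq_zero_of_mem_LA v.2.1))
      map_add' := fun x y => by ext1; simp
      map_smul' := fun c x => Subtype.ext (map_zsmul (D.analysis d U) c _) }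
  refine ⟨D.isEvenLattice_LA h.form_weight, f, fun x y => ?_, fun x => h.analysis_map hg x⟩
  change D.form (D.analysis d U (x : leech)) (D.analysis d U (y : leech)) = _
  -- By adjointness (f x | f y) = (f⁻¹ f x | y) = (x | y).
  rw [← leechForm_synthesis, h.synthesis_analysis hg x.2]

end IsometryCertificate
end GlueDatum

/-! ## The five classes -/

/-- The vectors listed in a table, component by component. -/
def GlueDatum.ofTable (D : GlueDatum) (T : List (List (List ℤ))) :
    ∀ i, Fin (D.k i) → Fin 24 → ℤ :=
  fun i a p => ((T.getD i []).getD a []).getD p 0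

/-! ### The class 4C -/

/-- Multiples by `4` of the images in `ℚ ⊗ Λ_g` of the unit vectors, for the class `4C`. -/
def inverse4C : List (List (List ℤ)) :=
  [[[1, -3, 3, -1, 3, 0, -2, 3, 1, 2, -1, -2, -1, 1, 0, -3, 1, 0, 3, -3, -1, -3, 2, 0],
    [-1, 3, -3, 1, 1, 0, 2, 1, -1, -2, -3, 2, -3, 3, 0, 3, -1, 0, 1, 3, -3, -1, -2, 0],
    [-3, 1, -1, 3, -1, 0, -2, -1, -3, 2, 3, -2, 3, -3, 0, 1, -3, 0, -1, 1, 3, 1, 2, 0],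
    [3, -1, 1, -3, -3, 0, 2, -3, 3, -2, 1, 2, 1, -1, 0, -1, 3, 0, -3, -1, 1, 3, -2, 0]],
   [[-1, 3, 1, -3, 3, 0, 2, -1, 1, 2, 3, -2, -1, -1, 0, 1, -3, 0, 1, -3, -3, 3, -2, 0],
    [-3, 1, 3, -1, 1, 0, -2, -3, -1, -2, 1, 2, -3, 1, 0, -1, 3, 0, -1, 3, 3, -3, 2, 0],
    [3, -1, -3, 1, -1, 0, 2, 3, -3, 2, -1, -2, 3, 3, 0, -3, 1, 0, -3, 1, 1, -1, -2, 0],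
    [1, -3, -1, 3, -3, 0, -2, 1, 3, -2, -3, 2, 1, -3, 0, 3, -1, 0, 3, -1, -1, 1, 2, 0]],
   [[-1, 3, -3, 1, -3, 0, -2, -3, 3, 2, 1, -2, 1, 3, 0, -1, 3, 0, 1, -1, -3, -1, 2, 0],
    [-3, 1, -1, 3, 3, 0, 2, 3, 1, -2, -1, 2, -1, -3, 0, -3, 1, 0, -1, -3, 3, 1, -2, 0],
    [3, -1, 1, -3, 1, 0, -2, 1, -1, 2, -3, -2, -3, -1, 0, 3, -1, 0, -3, 3, 1, 3, 2, 0],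
    [1, -3, 3, -1, -1, 0, 2, -1, -3, -2, 3, 2, 3, 1, 0, 1, -3, 0, 3, 1, -1, -3, -2, 0]],
   [[1, -3, -1, 3, 1, 0, 2, -3, -1, 2, 1, -2, -3, -3, 0, -1, 3, 0, 3, 3, -1, 1, -2, 0],
    [-1, 3, 1, -3, -1, 0, -2, 3, -3, -2, -1, 2, 3, -1, 0, -3, 1, 0, 1, 1, -3, 3, 2, 0],
    [-3, 1, 3, -1, -3, 0, 2, 1, 3, 2, -3, -2, 1, 1, 0, 3, -1, 0, -1, -1, 3, -3, -2, 0],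
    [3, -1, -3, 1, 3, 0, -2, -1, 1, -2, 3, 2, -1, 3, 0, 1, -3, 0, -3, -3, 1, -1, 2, 0]],
   [[-2, -2, -2, -2, -2, 0, 0, 2, 2, 0, 2, 0, -2, 2, 0, -2, -2, 0, 2, 2, 2, 2, 0, 0],
    [2, 2, 2, 2, 2, 0, 0, -2, -2, 0, -2, 0, 2, -2, 0, 2, 2, 0, -2, -2, -2, -2, 0, 0]],
   [[2, 2, 2, 2, -2, 0, 0, 2, 2, 0, 2, 0, -2, -2, 0, -2, -2, 0, -2, 2, -2, -2, 0, 0],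
    [-2, -2, -2, -2, 2, 0, 0, -2, -2, 0, -2, 0, 2, 2, 0, 2, 2, 0, 2, -2, 2, 2, 0, 0]]]

/-- Vectors of the Leech lattice that detect `L_A(C)`, for the class `4C`. -/
def detect4C : List (List (List ℤ)) :=
  -- The zero row belongs to (i₀, 0), whose functional is v_{i₀}(0) - v_{i₀}(0).
  [[[0, 0, 0, 0, 0, 0, 0, 0, 0, 0, 0, 0, 0, 0, 0, 0, 0, 0, 0, 0, 0, 0, 0, 0],
    [0, 2, -2, 0, 0, 2, 0, 0, 0, 0, 0, 2, 0, 0, 0, 2, 0, 0, 0, 2, 0, 0, -2, 2],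
    [-2, 0, -2, 0, 0, 0, 0, -2, 0, 0, 0, 0, 2, -2, 0, 0, -2, 0, -2, 2, 0, 0, 0, 0],
    [0, 0, 0, 0, 0, 0, 2, -2, 2, 0, 0, 2, 2, 0, 0, 0, 0, 0, -2, 2, 0, 2, 0, 0]],
   [[0, 2, 0, 0, 0, 0, 0, 0, 0, 2, 2, 2, 0, 0, -2, 2, 0, 0, 0, 0, 0, 2, -2, 0],
    [0, 2, 0, 0, 0, 0, 2, -2, 0, 0, 0, 2, 0, 0, -2, 0, 0, 0, 0, 2, 2, 0, 2, 0],
    [0, 0, -2, 0, -2, 0, 2, 0, -2, 2, 0, 2, 0, 0, 0, 0, 0, 2, -2, 0, 0, 0, 0, 0],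
    [0, 0, -2, 0, 0, 0, 0, 0, 2, 0, 0, 2, 2, -2, 0, 2, 0, 2, 0, 2, 0, 0, 0, 0]],
   [[0, 2, -2, 0, -2, -2, 2, -2, 0, 0, 0, 0, 0, 0, 0, 0, 0, 2, 0, 0, 0, 0, 2, 0],
    [-2, 0, -2, 0, 0, -2, 0, 0, 0, 0, 0, 2, 0, -2, 0, 0, 0, 2, -2, 0, 0, 0, -2, 0],
    [0, 0, 0, 0, 0, 0, 0, -2, 0, 0, -2, 0, 0, 0, 0, 0, -2, 2, -2, 2, 0, 2, 0, 2],
    [0, 0, 0, 0, 0, 0, 2, -2, 0, -2, 0, 0, 2, 0, 2, 0, -2, 0, 0, 2, 0, 0, 0, -2]],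
   [[0, 0, -2, 0, 0, -2, 2, -2, 0, 2, 0, 2, 0, -2, 0, 0, 0, 0, 0, 2, 0, 0, 0, 0],
    [-2, 0, 0, 0, -2, -2, 0, 0, -2, 0, 0, 2, 0, 0, 0, 0, 0, 0, -2, 0, -2, 2, 0, 0],
    [-2, 0, 0, 0, -2, -2, 2, 0, 0, 0, 0, 0, 0, 0, 2, 2, 0, 2, -2, 0, 0, 0, 0, 0],
    [2, 2, -2, 0, 0, -2, 0, -2, 0, 0, 0, 2, 0, 0, 0, 0, -2, 0, 0, 0, 2, 0, 0, 0]],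
   [[-1, 1, -3, -1, -3, 3, 1, -1, -1, -1, 1, 1, -1, -1, 1, 1, -1, -1, -1, 1, 1, 1, -1, 1],
    [1, 3, -1, 1, -1, 3, 1, -3, -1, -1, -1, 1, 1, -1, 1, 1, -1, -1, -1, 1, 1, 1, -1, 1]],
   [[1, 3, -1, 1, -3, -3, 1, -1, -1, -1, 1, 1, -1, -1, -1, 1, -1, 1, -1, 1, 1, 1, -1, -1],
    [-1, 1, -3, -1, -1, 5, 1, -3, -1, -1, -1, 1, 1, -1, -1, 1, -1, 1, -1, 1, 1, 1, -1, -1]]]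

/-- The images of the places under `perm4C`. -/
def image4C : Fin 24 → Fin 24 :=
  ![20, 18, 21, 13, 8, 5, 22, 16, 12, 11, 15, 9, 19, 2, 14, 7, 10, 17, 0, 4, 1, 3, 6, 23]

theorem perm4C_apply (p : Fin 24) : perm4C p = image4C p := by
  revert p
  decide +kernel

theorem certificate4C : glue4C.IsometryCertificate image4C
    1 4 ⟨0, by decide⟩
    (glue4C.ofTable inverse4C) (glue4C.ofTable detect4C)
    ![-2, 0, 0, 0, 2, 0, 0, 0, 2, 2, 0, 0, 0, 0, 0, -2, 0, -2, 0, 2, -2, 0, 0, 0] where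
  injective := by decide +kernel
  d_ne := by decide +kernel
  c_eq := by decide +kernel
  dvd := by decide +kernel
  norm := by decide +kernel
  coxeter := by decide +kernel
  transitive := by decide +kernel
  sum_U := by decide +kernel
  equivariant := by decide +kernel
  left_inv := by decide +kernel
  right_inv_ne := by decide +kernel
  right_inv := by decide +kernel
  W_mem := by decide +kernel
  W_fixed := by decide +kernel
  X_mem := by decide +kernel
  X_fixed := by decide +kernel
  gen_mem := by decide +kernel
  root_mem := by decide +kernel
  weight_mem := by decide +kernel

theorem coinvariantIsLB_rep4C : CoinvariantIsLB rep4C glue4C := by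
  refine certificate4C.coinvariantIsLB fun x p => ?_
  change (x : Fin 24 → ℚ) (perm4C p) = ((1 : ℤ) : ℚ) * _
  rw [Int.cast_one, one_mul, perm4C_apply]

/-! ### The class 6E -/

/-- Multiples by `6` of the images in `ℚ ⊗ Λ_g` of the unit vectors, for the class `6E`. -/
def inverse6E : List (List (List ℤ)) :=
  [[[0, 4, 0, 0, 5, 0, -4, 6, -6, 2, -3, 2, -2, -3, 1, -1, -2, -5, 4, 3, 0, 3, -4, 0],
    [4, -4, 0, 0, 3, 4, 0, -2, -2, 6, 3, -6, 2, -5, -1, -3, 2, 5, -4, -3, 0, 1, 0, 0],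
    [-4, 0, 0, 0, 1, -4, 4, 2, 2, -2, -3, -2, 6, 5, -3, -5, -6, 3, 0, 3, 0, -1, 4, 0],
    [0, 4, 0, 0, -1, 0, -4, -6, 6, 2, 3, 2, -2, 3, -5, 5, -2, 1, 4, -3, 0, -3, -4, 0],
    [4, -4, 0, 0, -3, 4, 0, -2, -2, -6, -3, 6, 2, 1, 5, 3, 2, -1, -4, 3, 0, -5, 0, 0],
    [-4, 0, 0, 0, -5, -4, 4, 2, 2, -2, 3, -2, -6, -1, 3, 1, 6, -3, 0, -3, 0, 5, 4, 0]],
   [[4, 4, 0, 0, 1, 0, -4, 2, 2, -2, -3, -2, -6, 5, -3, -5, 6, 3, -4, 3, 0, -1, 0, 0],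
    [-4, -4, 0, 0, -1, 4, 0, 6, -6, 2, 3, 2, -2, 3, -5, 5, -2, 1, 0, -3, 0, -3, 4, 0],
    [0, 0, 0, 0, -3, -4, 4, -2, -2, 6, -3, -6, 2, 1, 5, 3, 2, -1, 4, 3, 0, -5, -4, 0],
    [4, 4, 0, 0, -5, 0, -4, 2, 2, -2, 3, -2, 6, -1, 3, 1, -6, -3, -4, -3, 0, 5, 0, 0],
    [-4, -4, 0, 0, 5, 4, 0, -6, 6, 2, -3, 2, -2, -3, 1, -1, -2, -5, 0, 3, 0, 3, 4, 0],
    [0, 0, 0, 0, 3, -4, 4, -2, -2, -6, 3, 6, 2, -5, -1, -3, 2, 5, 4, -3, 0, 1, -4, 0]],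
   [[4, -4, 0, 0, 4, 0, 4, 4, 4, -4, 0, -4, 0, 0, -4, 4, 0, -4, 0, 0, 0, 0, -4, 0],
    [0, 4, 0, 0, 0, -4, 0, 0, 0, 4, 0, 4, -4, -4, 4, 0, -4, 4, -4, 0, 0, -4, 4, 0],
    [-4, 0, 0, 0, -4, 4, -4, -4, -4, 0, 0, 0, 4, 4, 0, -4, 4, 0, 4, 0, 0, 4, 0, 0]],
   [[4, -4, 0, 0, -4, 0, 4, 0, 0, 4, 0, 4, -4, 4, 0, -4, -4, 0, 0, 0, 0, 4, -4, 0],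
    [0, 4, 0, 0, 4, -4, 0, -4, -4, 0, 0, 0, 4, 0, -4, 4, 4, -4, -4, 0, 0, 0, 4, 0],
    [-4, 0, 0, 0, 0, 4, -4, 4, 4, -4, 0, -4, 0, -4, 4, 0, 0, 4, 4, 0, 0, -4, 0, 0]],
   [[0, 0, 6, -6, 3, 0, 0, 0, 0, 0, 3, 0, 0, 3, 3, -3, 0, -3, 0, -3, 0, -3, 0, 0],
    [0, 0, -6, 6, -3, 0, 0, 0, 0, 0, -3, 0, 0, -3, -3, 3, 0, 3, 0, 3, 0, 3, 0, 0]],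
   [[0, 0, -6, 6, 3, 0, 0, 0, 0, 0, 3, 0, 0, 3, 3, -3, 0, -3, 0, -3, 0, -3, 0, 0],
    [0, 0, 6, -6, -3, 0, 0, 0, 0, 0, -3, 0, 0, -3, -3, 3, 0, 3, 0, 3, 0, 3, 0, 0]]]

/-- Vectors of the Leech lattice that detect `L_A(C)`, for the class `6E`. -/
def detect6E : List (List (List ℤ)) :=
  [[[0, 0, 0, 0, 0, 0, 0, 0, 0, 0, 0, 0, 0, 0, 0, 0, 0, 0, 0, 0, 0, 0, 0, 0],
    [0, 0, 0, 0, 0, 2, 2, -2, 0, 0, 2, -2, 0, 0, 0, 0, 0, 2, -2, 0, -2, 0, 0, 0],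
    [0, -2, 0, 0, 0, -2, 0, 0, 2, 0, 0, 0, 2, 2, 0, 0, 0, 2, 0, 0, 0, 0, 2, 2],
    [0, 0, 0, 0, 0, 0, 0, -2, 2, 0, 2, 0, 0, 2, 0, 2, 0, 2, 0, 0, 2, 0, 0, -2],
    [0, 0, 0, 0, -2, 2, 2, -2, 0, -2, 0, 0, 0, 0, 0, 0, 0, 0, -2, 0, 0, -2, 0, -2],
    [-2, 0, 0, 0, -2, 0, 2, 0, 2, 0, 0, 0, 0, 0, 0, 0, 2, 0, -2, -2, 0, 0, 0, 2]],
   [[0, 0, 2, 2, 0, 0, 0, 0, 2, 0, 0, 0, 0, 2, 0, 0, 2, 2, -2, 0, 0, 0, 0, -2],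
    [0, 0, 0, 0, 0, 2, 2, 0, 0, 0, 0, 0, 0, 2, 0, 2, 0, 2, 0, -2, -2, 0, 2, 0],
    [0, 0, 2, 2, -2, 0, 2, -2, 0, 0, 0, -2, 0, 0, 0, 0, 0, 0, 0, 0, 2, -2, 0, 0],
    [0, 0, 2, 2, -2, 0, 0, 0, 2, 0, 0, 0, 2, 0, 0, 0, 0, 0, -2, -2, -2, 0, 0, 0],
    [-2, -2, 0, 0, 0, 0, 0, -2, 2, 0, 2, 0, 0, 0, 0, 0, 0, 0, -2, 2, 2, 0, 0, 0],
    [0, 0, 0, 0, 0, 0, 2, 0, 2, 0, 2, 2, 2, 0, 0, 0, 2, 2, 0, 0, 0, 0, 0, 2]],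
   [[1, 1, -1, -1, -1, 3, 5, -1, 3, -1, 1, -1, 1, 1, -1, 1, 1, 1, -1, -1, 1, -1, 1, 1],
    [-1, -1, 1, 1, -1, -1, 1, -3, 1, -1, 1, -1, -1, 1, 1, 1, -1, 3, -3, -1, -1, -1, 1, 1],
    [0, -2, 0, 0, -2, 0, 0, -4, 0, -2, 0, -2, 0, 2, 0, 0, 0, 2, 0, -2, 0, 0, 2, 0]],
   [[0, -4, 0, 0, -4, -2, 0, -2, 2, 0, 2, 0, 0, 0, -2, -2, 0, 0, -2, 0, 0, -2, 0, 0],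
    [-1, 1, 1, 1, -1, 1, 3, -3, 1, -1, 1, -1, 1, 1, -1, 1, 1, 1, -3, -1, 1, -1, 1, 1],
    [0, -2, 0, 0, -2, 0, 0, 0, 4, 0, 2, 0, 2, 0, 0, 0, 2, 2, 0, 0, 0, -2, 2, 0]],
   [[-1, -1, 1, -1, -3, 1, 3, -3, 3, -1, 3, -1, 1, 1, -1, -1, 1, 1, -3, -1, -1, -3, 1, 1],
    [1, -1, -3, -1, -3, 1, 3, -3, 3, -1, 1, -1, 1, 1, -1, 1, 1, 3, -1, -1, 1, -1, 3, 1]],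
   [[1, -1, -1, 1, -3, 1, 3, -3, 3, -1, 1, -1, 1, 1, -1, -1, 1, 1, -1, -3, -1, -3, 3, -1],
    [-1, -3, 1, -1, -3, -1, 1, -3, 3, -1, 1, -1, 1, 1, -1, 1, 1, 3, -3, -1, -1, -1, 1, 3]]]

/-- The images of the places under `perm6E`. -/
def image6E : Fin 24 → Fin 24 :=
  ![18, 6, 3, 2, 21, 1, 5, 16, 12, 7, 19, 8, 9, 17, 15, 13, 11, 4, 22, 10, 20, 14, 0, 23]

theorem perm6E_apply (p : Fin 24) : perm6E p = image6E p := by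
  revert p
  decide +kernel

theorem certificate6E : glue6E.IsometryCertificate image6E
    1 6 ⟨0, by decide⟩
    (glue6E.ofTable inverse6E) (glue6E.ofTable detect6E)
    ![0, 0, 0, 0, 2, 0, 0, 0, -2, 0, 0, -2, -2, 2, 0, 0, -2, 0, -2, 0, 0, 0, -2, 0] where
  injective := by decide +kernel
  d_ne := by decide +kernel
  c_eq := by decide +kernel
  dvd := by decide +kernel
  norm := by decide +kernel
  coxeter := by decide +kernel
  transitive := by decide +kernel
  sum_U := by decide +kernel
  equivariant := by decide +kernel
  left_inv := by decide +kernel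
  right_inv_ne := by decide +kernel
  right_inv := by decide +kernel
  W_mem := by decide +kernel
  W_fixed := by decide +kernel
  X_mem := by decide +kernel
  X_fixed := by decide +kernel
  gen_mem := by decide +kernel
  root_mem := by decide +kernel
  weight_mem := by decide +kernel

theorem coinvariantIsLB_rep6E : CoinvariantIsLB rep6E glue6E := by
  refine certificate6E.coinvariantIsLB fun x p => ?_
  change (x : Fin 24 → ℚ) (perm6E p) = ((1 : ℤ) : ℚ) * _
  rw [Int.cast_one, one_mul, perm6E_apply]

/-! ### The class 6G -/

/-- Multiples by `3` of the images in `ℚ ⊗ Λ_g` of the unit vectors, for the class `6G`. -/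
def inverse6G : List (List (List ℤ)) :=
  [[[0, 2, 0, 0, 0, 0, 2, 0, 2, -2, 0, 0, 0, 0, 0, 2, 0, 0, 0, 0, 0, -2, -6, 0],
    [6, 0, 0, 0, 0, -2, -2, 0, -2, 0, 0, 0, 0, 0, 0, 0, 2, -2, 0, 0, 0, 2, 0, 0],
    [0, -2, 0, 0, 0, 2, 0, 0, 0, 2, 0, 0, 0, 0, 0, -2, -2, 2, 6, 0, 0, 0, 0, 0],
    [0, 2, 0, 0, 0, 0, 2, 0, 2, -2, 0, 0, 0, 0, 0, 2, 0, 0, 0, 0, 0, -2, 6, 0],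
    [-6, 0, 0, 0, 0, -2, -2, 0, -2, 0, 0, 0, 0, 0, 0, 0, 2, -2, 0, 0, 0, 2, 0, 0],
    [0, -2, 0, 0, 0, 2, 0, 0, 0, 2, 0, 0, 0, 0, 0, -2, -2, 2, -6, 0, 0, 0, 0, 0]],
   [[0, -2, 0, 0, 0, 2, 0, 0, 2, -2, 0, 0, 0, 6, 0, 0, 0, -2, 0, 0, 0, 2, 0, 0],
    [0, 2, 0, 0, 0, 0, 2, 0, -2, 0, 0, 0, 0, 0, 6, -2, 2, 2, 0, 0, 0, 0, 0, 0],
    [0, 0, 0, 0, -6, -2, -2, 0, 0, 2, 0, 0, 0, 0, 0, 2, -2, 0, 0, 0, 0, -2, 0, 0],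
    [0, -2, 0, 0, 0, 2, 0, 0, 2, -2, 0, 0, 0, -6, 0, 0, 0, -2, 0, 0, 0, 2, 0, 0],
    [0, 2, 0, 0, 0, 0, 2, 0, -2, 0, 0, 0, 0, 0, -6, -2, 2, 2, 0, 0, 0, 0, 0, 0],
    [0, 0, 0, 0, 6, -2, -2, 0, 0, 2, 0, 0, 0, 0, 0, 2, -2, 0, 0, 0, 0, -2, 0, 0]],
   [[0, 0, 0, 0, 0, -2, -2, 0, 2, -2, 0, 6, 0, 0, 0, -2, 0, 2, 0, 0, 0, 0, 0, 0],
    [0, -2, 0, 0, 0, 2, 0, 6, -2, 0, 0, 0, 0, 0, 0, 2, 2, 0, 0, 0, 0, -2, 0, 0],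
    [0, 2, 0, 0, 0, 0, 2, 0, 0, 2, 0, 0, 6, 0, 0, 0, -2, -2, 0, 0, 0, 2, 0, 0],
    [0, 0, 0, 0, 0, -2, -2, 0, 2, -2, 0, -6, 0, 0, 0, -2, 0, 2, 0, 0, 0, 0, 0, 0],
    [0, -2, 0, 0, 0, 2, 0, -6, -2, 0, 0, 0, 0, 0, 0, 2, 2, 0, 0, 0, 0, -2, 0, 0],
    [0, 2, 0, 0, 0, 0, 2, 0, 0, 2, 0, 0, -6, 0, 0, 0, -2, -2, 0, 0, 0, 2, 0, 0]],
   [[0, 0, 0, 0, 0, 0, 0, 0, 0, 0, 0, 0, 0, 0, 0, 0, 0, 0, 0, 0, 0, 0, 0, 6],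
    [0, 0, 0, 0, 0, 0, 0, 0, 0, 0, 0, 0, 0, 0, 0, 0, 0, 0, 0, 0, 0, 0, 0, -6]],
   [[0, 0, 6, 0, 0, 0, 0, 0, 0, 0, 0, 0, 0, 0, 0, 0, 0, 0, 0, 0, 0, 0, 0, 0],
    [0, 0, -6, 0, 0, 0, 0, 0, 0, 0, 0, 0, 0, 0, 0, 0, 0, 0, 0, 0, 0, 0, 0, 0]],
   [[0, 0, 0, 0, 0, 0, 0, 0, 0, 0, 6, 0, 0, 0, 0, 0, 0, 0, 0, 0, 0, 0, 0, 0],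
    [0, 0, 0, 0, 0, 0, 0, 0, 0, 0, -6, 0, 0, 0, 0, 0, 0, 0, 0, 0, 0, 0, 0, 0]]]

/-- Vectors of the Leech lattice that detect `L_A(C)`, for the class `6G`. -/
def detect6G : List (List (List ℤ)) :=
  [[[0, 0, 0, 0, 0, 0, 0, 0, 0, 0, 0, 0, 0, 0, 0, 0, 0, 0, 0, 0, 0, 0, 0, 0],
    [2, -2, 0, 0, 0, -2, 0, 0, 0, 2, 0, 0, 0, 0, 0, -2, 2, -2, 0, 0, 0, 0, 2, 0],
    [0, -2, 0, 2, 0, 0, 0, 0, 0, 2, 0, 0, 0, 0, 0, -2, 0, 0, 2, 2, 2, 0, 2, 0],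
    [0, 0, 0, 4, 0, 0, 0, 0, 0, 0, 0, 0, 0, 0, 0, 0, 0, 0, 0, 0, 0, 0, 4, 0],
    [-2, 0, 0, -2, 0, 0, -2, 0, -2, 0, 0, 0, 0, 0, 0, 0, 0, 0, 0, 2, 2, 2, 2, 0],
    [0, 0, 0, 0, 0, 2, -2, 0, -2, 0, 0, 0, 0, 0, 0, 0, -2, 2, -2, 0, 0, 2, 2, 0]],
   [[0, 0, 0, 0, 0, 2, -2, 0, 0, 0, 0, 0, 0, 2, 0, -2, 0, -2, 0, -2, 2, 0, 2, 0],
    [0, 0, 0, 0, 0, 0, 0, 0, 0, 2, 0, 0, 0, 0, 2, 0, 2, 2, 0, 2, 2, 2, 2, 0],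
    [0, -2, 0, 0, -2, -2, 0, 0, -2, 0, 0, 0, 0, 0, 0, 0, -2, 0, 0, -2, 2, 0, 2, 0],
    [0, 0, 0, 0, 0, 2, -2, 0, 0, 0, 0, 0, 0, -2, 0, -2, 0, -2, 0, 2, 2, 0, 2, 0],
    [0, 0, 0, 0, 0, 0, 0, 0, 0, 2, 0, 0, 0, 0, -2, 0, 2, 2, 0, -2, 2, 2, 2, 0],
    [0, -2, 0, 0, 2, -2, 0, 0, -2, 0, 0, 0, 0, 0, 0, 0, -2, 0, 0, 2, 2, 0, 2, 0]],
   [[0, -2, 0, 2, 0, -2, 0, 0, 0, 0, 0, 2, 0, 0, 0, 0, 0, 2, 0, 0, 2, 2, 2, 0],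
    [0, 0, 0, -2, 0, 2, -2, 2, 0, 2, 0, 0, 0, 0, 0, 0, 2, 0, 0, 0, 2, 0, 2, 0],
    [0, -2, 0, 0, 0, -2, 2, 0, 0, 2, 0, 0, 2, 0, 0, 0, 0, 0, 0, 2, 0, 2, 2, 0],
    [0, -2, 0, -2, 0, -2, 0, 0, 0, 0, 0, -2, 0, 0, 0, 0, 0, 2, 0, 0, 2, 2, 2, 0],
    [0, 0, 0, 2, 0, 2, -2, -2, 0, 2, 0, 0, 0, 0, 0, 0, 2, 0, 0, 0, 2, 0, 2, 0],
    [0, 2, 0, 0, 0, 2, -2, 0, 0, 2, 0, 0, -2, 0, 0, 0, 0, 0, 0, 2, 0, 2, 2, 0]],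
   [[0, -4, 0, 0, 0, -2, 0, 0, -2, 2, 0, 0, 0, 0, 0, -2, 0, 0, 0, 0, -2, 2, 6, 2],
    [0, -4, 0, 0, 0, -2, 0, 0, -2, 2, 0, 0, 0, 0, 0, -2, 0, 0, 0, 0, 2, 2, 6, -2]],
   [[0, -2, 2, 0, 0, 0, -2, 0, -4, 0, 0, 0, 0, 0, 0, -2, -2, 0, 0, 0, 2, 2, 6, 0],
    [0, -2, -2, 0, 0, 0, -2, 0, -4, 0, 0, 0, 0, 0, 0, -2, -2, 0, 0, 0, -2, 2, 6, 0]],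
   [[0, -2, 0, 0, 0, 0, -2, 0, -2, 2, 2, 0, 0, 0, 0, -4, 0, -2, 0, 0, 2, 0, 6, 0],
    [0, -2, 0, 0, 0, 0, -2, 0, -2, 2, -2, 0, 0, 0, 0, -4, 0, -2, 0, 0, -2, 0, 6, 0]]]

/-- The images of the places under `perm6G`. -/
def image6G : Fin 24 → Fin 24 :=
  ![22, 5, 2, 3, 14, 6, 1, 11, 9, 16, 10, 12, 7, 4, 13, 17, 8, 21, 0, 19, 20, 15, 18, 23]

theorem perm6G_apply (p : Fin 24) : perm6G p = image6G p := by
  revert p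
  decide +kernel

/-- The A_1 components are carried by the coordinates 23, 2 and 10, which `perm6G` fixes and the
octad sign negates. -/
theorem certificate6G : glue6G.IsometryCertificate image6G
    octadSign 3 ⟨0, by decide⟩
    (glue6G.ofTable inverse6G) (glue6G.ofTable detect6G)
    ![1, -1, 1, 1, -1, -1, 1, 1, -1, -3, 1, 1, 1, 1, 1, 1, -1, 1, 1, -1, -1, 1, -1, 1] where
  injective := by decide +kernel
  d_ne := by decide +kernel
  c_eq := by decide +kernel
  dvd := by decide +kernel
  norm := by decide +kernel
  coxeter := by decide +kernel
  transitive := by decide +kernel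
  sum_U := by decide +kernel
  equivariant := by decide +kernel
  left_inv := by decide +kernel
  right_inv_ne := by decide +kernel
  right_inv := by decide +kernel
  W_mem := by decide +kernel
  W_fixed := by decide +kernel
  X_mem := by decide +kernel
  X_fixed := by decide +kernel
  gen_mem := by decide +kernel
  root_mem := by decide +kernel
  weight_mem := by decide +kernel

theorem coinvariantIsLB_rep6G : CoinvariantIsLB rep6G glue6G := by
  refine certificate6G.coinvariantIsLB fun x p => ?_
  change (octadSign p : ℚ) * (x : Fin 24 → ℚ) (perm6G p) = _
  rw [perm6G_apply]

/-! ### The class 8E -/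

/-- Multiples by `4` of the images in `ℚ ⊗ Λ_g` of the unit vectors, for the class `8E`. -/
def inverse8E : List (List (List ℤ)) :=
  [[[3, 0, -5, -1, 2, -2, 0, 0, 0, 2, -1, 0, 3, -4, -2, -1, 0, 2, 3, 4, -1, -2, 0, 0],
    [-1, 0, -1, 3, -2, -4, 0, -2, 0, 0, 3, 0, -1, 2, 4, -5, -2, 0, -1, 2, 3, 2, 0, 0],
    [3, 0, 3, -1, 2, 2, 0, -4, 0, -2, -1, 0, -5, 0, 2, -1, 4, -2, 3, 0, -1, -2, 0, 0],
    [-1, 0, -1, 3, -2, 0, 0, 2, 0, 4, -5, 0, -1, -2, 0, 3, 2, -4, -1, -2, 3, 2, 0, 0],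
    [3, 0, 3, -1, 2, -2, 0, 0, 0, 2, -1, 0, 3, 4, -2, -1, 0, 2, -5, -4, -1, -2, 0, 0],
    [-1, 0, -1, -5, -2, 4, 0, -2, 0, 0, 3, 0, -1, 2, -4, 3, -2, 0, -1, 2, 3, 2, 0, 0],
    [-5, 0, 3, -1, 2, 2, 0, 4, 0, -2, -1, 0, 3, 0, 2, -1, -4, -2, 3, 0, -1, -2, 0, 0],
    [-1, 0, -1, 3, -2, 0, 0, 2, 0, -4, 3, 0, -1, -2, 0, 3, 2, 4, -1, -2, -5, 2, 0, 0]],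
   [[3, 0, 3, -1, -2, -2, 0, 4, 0, 2, -1, 0, -5, 0, -2, -1, -4, 2, 3, 0, -1, 2, 0, 0],
    [-1, 0, -1, -5, 2, -4, 0, 2, 0, 0, 3, 0, -1, -2, 4, 3, 2, 0, -1, -2, 3, -2, 0, 0],
    [3, 0, -5, -1, -2, 2, 0, 0, 0, -2, -1, 0, 3, 4, 2, -1, 0, -2, 3, -4, -1, 2, 0, 0],
    [-1, 0, -1, 3, 2, 0, 0, -2, 0, -4, -5, 0, -1, 2, 0, 3, -2, 4, -1, 2, 3, -2, 0, 0],
    [-5, 0, 3, -1, -2, -2, 0, -4, 0, 2, -1, 0, 3, 0, -2, -1, 4, 2, 3, 0, -1, 2, 0, 0],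
    [-1, 0, -1, 3, 2, 4, 0, 2, 0, 0, 3, 0, -1, -2, -4, -5, 2, 0, -1, -2, 3, -2, 0, 0],
    [3, 0, 3, -1, -2, 2, 0, 0, 0, -2, -1, 0, 3, -4, 2, -1, 0, -2, -5, 4, -1, 2, 0, 0],
    [-1, 0, -1, 3, 2, 0, 0, -2, 0, 4, 3, 0, -1, 2, 0, 3, -2, -4, -1, 2, -5, -2, 0, 0]],
   [[0, 4, 0, 0, 0, -2, 4, 2, -4, -2, 0, 0, 0, 2, -2, 0, 2, -2, 0, 2, 0, 0, -4, 0],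
    [0, 4, 0, 0, 0, 2, -4, -2, -4, 2, 0, 0, 0, -2, 2, 0, -2, 2, 0, -2, 0, 0, 4, 0],
    [0, -4, 0, 0, 0, -2, -4, 2, 4, -2, 0, 0, 0, 2, -2, 0, 2, -2, 0, 2, 0, 0, 4, 0],
    [0, -4, 0, 0, 0, 2, 4, -2, 4, 2, 0, 0, 0, -2, 2, 0, -2, 2, 0, -2, 0, 0, -4, 0]],
   [[0, -4, 0, 0, 0, 0, 4, 0, -4, 0, 0, 0, 0, 0, 0, 0, 0, 0, 0, 0, 0, 0, 4, 0],
    [0, 4, 0, 0, 0, 0, -4, 0, 4, 0, 0, 0, 0, 0, 0, 0, 0, 0, 0, 0, 0, 0, -4, 0]]]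

/-- Vectors of the Leech lattice that detect `L_A(C)`, for the class `8E`. -/
def detect8E : List (List (List ℤ)) :=
  [[[0, 0, 0, 0, 0, 0, 0, 0, 0, 0, 0, 0, 0, 0, 0, 0, 0, 0, 0, 0, 0, 0, 0, 0],
    [0, 0, 2, 2, -2, 0, 0, 0, 0, 0, 2, 0, 0, 2, 2, 0, 0, 0, 0, 0, 2, 0, 0, -2],
    [0, 0, 2, 0, 0, 2, 0, 0, 0, 0, 0, 2, -2, 2, 2, 0, 2, 0, 0, 0, 0, 0, 0, -2],
    [-2, 0, 0, 0, -2, 0, 0, 0, 0, 0, -2, -2, -2, 0, 0, 0, 0, -2, -2, -2, 0, 0, 0, 0],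
    [0, 2, 2, 0, 0, 0, 2, 0, 2, 0, 0, 0, 0, 2, 0, 0, 0, 0, -2, -2, 0, 0, 2, 0],
    [-2, 0, 0, -2, -2, 2, 0, 0, 0, 0, 0, 0, -2, 2, 0, 0, 0, 0, -2, 0, 0, 0, 0, -2],
    [-2, 0, 2, 0, 0, 0, 0, 0, 0, -2, 0, 2, 0, 0, 0, 0, -2, -2, 0, -2, 0, 0, 0, -2],
    [-2, 0, 0, 0, 0, 0, 0, 0, 0, -2, 0, 0, -2, 0, 0, 0, 0, 0, -2, -2, -2, 2, 0, 2]],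
   [[-1, 1, 5, 1, -1, 1, 1, 1, 1, -1, 1, 1, -3, 3, 1, 1, -1, -1, -1, -3, 1, 3, 1, 1],
    [-3, -1, 3, -1, -1, 1, -1, 1, -1, -1, 1, 1, -3, 3, 3, 1, 1, -1, -3, -3, 1, 1, -1, -1],
    [-2, 0, 2, 0, -2, 2, 0, 0, 0, -2, 0, -2, -2, 4, 2, 0, 0, -2, -2, -4, 0, 2, 0, -2],
    [-3, 1, 3, 1, -1, 1, 1, -1, 1, -3, -1, -1, -3, 3, 1, 1, -1, -1, -3, -3, 1, 1, 1, 1],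
    [-3, 1, 5, 1, -3, 1, 1, -1, 1, -1, 1, -1, -1, 3, 1, 1, 1, -1, -1, -3, 1, 1, 1, -1],
    [-3, 1, 3, 1, -1, 3, 1, 1, 1, -1, 1, 1, -3, 3, 1, -1, 1, -1, -3, -3, 1, 1, 1, -1],
    [-2, 0, 4, 0, 0, 2, 0, 0, 0, -2, 0, 0, -2, 2, 2, 0, 0, -2, -4, -2, 0, 4, 0, 0],
    [-2, 0, 4, 2, 0, 2, 0, 0, 0, 0, 2, 0, -2, 4, 2, 2, 0, -2, -2, -2, 0, 2, 0, -2]],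
   [[-1, 1, 3, 1, -1, 1, 1, 1, -1, -1, 1, 5, -1, 3, 1, 1, 1, -1, -1, -1, 1, 1, -1, -1],
    [-1, 1, 3, 1, -3, 1, -1, -1, -1, -1, 1, 1, -1, 1, 1, 1, -1, -1, -1, -3, 1, -1, 1, -1],
    [-1, -1, 3, 1, -3, 1, -1, 1, 1, -1, 1, -1, -1, 3, 1, 1, 1, -1, -1, -1, 1, -1, 1, 1],
    [-1, -1, 3, 1, -1, 1, 1, -1, 1, -1, 1, 3, -1, 1, 1, 1, -1, -1, -1, -3, 1, 1, -1, 1]],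
   [[-5, -1, 3, -1, -3, 3, 1, 1, -1, -1, -1, -1, -5, 5, 3, -1, 1, -1, -5, -3, -1, 1, 1, -1],
    [-5, 3, 3, -1, -3, 3, 1, 1, 3, -1, -1, -1, -5, 5, 3, -1, 1, -1, -5, -3, -1, 1, 1, -1]]]

/-- The images of the places under `perm8E`. -/
def image8E : Fin 24 → Fin 24 :=
  ![3, 6, 20, 18, 21, 13, 8, 5, 22, 16, 12, 11, 15, 9, 19, 2, 14, 7, 10, 17, 0, 4, 1, 23]

theorem perm8E_apply (p : Fin 24) : perm8E p = image8E p := by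
  revert p
  decide +kernel

theorem certificate8E : glue8E.IsometryCertificate image8E
    1 4 ⟨0, by decide⟩
    (glue8E.ofTable inverse8E) (glue8E.ofTable detect8E)
    ![2, 0, 0, 0, 2, -2, 0, 0, -2, 0, 0, 2, 0, 0, 0, 0, 0, 0, 2, 0, 2, 2, 0, 0] where
  injective := by decide +kernel
  d_ne := by decide +kernel
  c_eq := by decide +kernel
  dvd := by decide +kernel
  norm := by decide +kernel
  coxeter := by decide +kernel
  transitive := by decide +kernel
  sum_U := by decide +kernel
  equivariant := by decide +kernel
  left_inv := by decide +kernel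
  right_inv_ne := by decide +kernel
  right_inv := by decide +kernel
  W_mem := by decide +kernel
  W_fixed := by decide +kernel
  X_mem := by decide +kernel
  X_fixed := by decide +kernel
  gen_mem := by decide +kernel
  root_mem := by decide +kernel
  weight_mem := by decide +kernel

theorem coinvariantIsLB_rep8E : CoinvariantIsLB rep8E glue8E := by
  refine certificate8E.coinvariantIsLB fun x p => ?_
  change (x : Fin 24 → ℚ) (perm8E p) = ((1 : ℤ) : ℚ) * _
  rw [Int.cast_one, one_mul, perm8E_apply]

/-! ### The class 10F -/

/-- Multiples by `5` of the images in `ℚ ⊗ Λ_g` of the unit vectors, for the class `10F`. -/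
def inverse10F : List (List (List ℤ)) :=
  [[[0, -1, 1, 0, -3, -5, 5, 3, -1, 5, 1, 1, -3, 3, 3, 0, 1, -3, 3, -5, -1, -3, -1, 0],
    [0, 3, -5, 0, 1, -3, -1, 5, 1, -3, 3, 5, -1, -5, -3, 0, 3, 1, -3, -1, 1, -1, 3, 0],
    [0, -3, -1, 0, 5, -1, 3, -3, 3, -1, -5, -1, 1, -3, 1, 0, 5, -5, 1, 3, 3, 1, -3, 0],
    [0, 1, 3, 0, -1, 1, -3, -1, -5, 1, -3, 3, 3, -1, 5, 0, -3, -1, -5, -3, 5, 3, 1, 0],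
    [0, 5, -3, 0, 3, 3, 1, 1, -3, 3, -1, -3, 5, 1, -1, 0, -1, 3, -1, 1, -3, -5, -5, 0],
    [0, -1, 1, 0, -3, 5, -5, 3, -1, -5, 1, 1, -3, 3, 3, 0, 1, -3, 3, 5, -1, -3, -1, 0],
    [0, 3, 5, 0, 1, -3, -1, -5, 1, -3, 3, -5, -1, 5, -3, 0, 3, 1, -3, -1, 1, -1, 3, 0],
    [0, -3, -1, 0, -5, -1, 3, -3, 3, -1, 5, -1, 1, -3, 1, 0, -5, 5, 1, 3, 3, 1, -3, 0],
    [0, 1, 3, 0, -1, 1, -3, -1, 5, 1, -3, 3, 3, -1, -5, 0, -3, -1, 5, -3, -5, 3, 1, 0],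
    [0, -5, -3, 0, 3, 3, 1, 1, -3, 3, -1, -3, -5, 1, -1, 0, -1, 3, -1, 1, -3, 5, 5, 0]],
   [[0, 3, -1, 0, -3, 3, 1, -3, -5, 3, 1, -1, -1, -3, -5, 0, 1, -3, 5, 1, 5, -1, 3, 0],
    [0, -3, 3, 0, 1, -5, -5, -1, -3, 5, 3, 3, 1, -1, -1, 0, 3, 1, -1, 5, -3, 1, -3, 0],
    [0, 1, -3, 0, 5, -3, -1, 1, -1, -3, 5, -3, 3, 1, 3, 0, -5, -5, 3, -1, -1, 3, 1, 0],
    [0, -5, 1, 0, -1, -1, 3, 3, 1, -1, -3, 1, 5, 3, -3, 0, -3, -1, -3, 3, 1, -5, 5, 0],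
    [0, -1, 5, 0, 3, 1, -3, 5, 3, 1, -1, -5, -3, -5, 1, 0, -1, 3, 1, -3, 3, -3, -1, 0],
    [0, 3, -1, 0, -3, 3, 1, -3, 5, 3, 1, -1, -1, -3, 5, 0, 1, -3, -5, 1, -5, -1, 3, 0],
    [0, -3, 3, 0, 1, 5, 5, -1, -3, -5, 3, 3, 1, -1, -1, 0, 3, 1, -1, -5, -3, 1, -3, 0],
    [0, 1, -3, 0, -5, -3, -1, 1, -1, -3, -5, -3, 3, 1, 3, 0, 5, 5, 3, -1, -1, 3, 1, 0],
    [0, 5, 1, 0, -1, -1, 3, 3, 1, -1, -3, 1, -5, 3, -3, 0, -3, -1, -3, 3, 1, 5, -5, 0],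
    [0, -1, -5, 0, 3, 1, -3, -5, 3, 1, -1, 5, -3, 5, 1, 0, -1, 3, 1, -3, 3, -3, -1, 0]],
   [[5, 0, 0, 5, 0, 0, 0, 0, 0, 0, 0, 0, 0, 0, 0, -5, 0, 0, 0, 0, 0, 0, 0, -5],
    [-5, 0, 0, -5, 0, 0, 0, 0, 0, 0, 0, 0, 0, 0, 0, 5, 0, 0, 0, 0, 0, 0, 0, 5]],
   [[5, 0, 0, -5, 0, 0, 0, 0, 0, 0, 0, 0, 0, 0, 0, 5, 0, 0, 0, 0, 0, 0, 0, -5],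
    [-5, 0, 0, 5, 0, 0, 0, 0, 0, 0, 0, 0, 0, 0, 0, -5, 0, 0, 0, 0, 0, 0, 0, 5]]]

/-- Vectors of the Leech lattice that detect `L_A(C)`, for the class `10F`. -/
def detect10F : List (List (List ℤ)) :=
  [[[0, 0, 0, 0, 0, 0, 0, 0, 0, 0, 0, 0, 0, 0, 0, 0, 0, 0, 0, 0, 0, 0, 0, 0],
    [2, 0, -2, 0, 0, 0, -2, 0, 0, -2, 0, 0, 0, -2, -2, 0, 0, 0, -2, 0, 0, 0, 0, 2],
    [2, 0, 0, 0, 2, 0, 0, -2, 0, -2, -2, 0, 0, -2, 0, 0, 0, 0, 0, 2, 0, 0, 0, 2],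
    [0, 0, 0, 0, 0, 0, -2, -2, -2, -2, -2, 0, 0, -2, 0, 0, -2, 0, -2, 0, 0, 0, 0, 0],
    [0, 2, 0, 2, 2, 2, 0, 0, 0, 0, 0, 0, 2, 0, 0, 2, 0, 2, 0, 2, 0, 0, 0, 0],
    [2, 0, 0, 2, 0, 2, -2, 0, 0, -2, 0, 0, 0, 0, 0, 2, 0, 0, 0, 2, 0, 0, 0, 2],
    [0, 0, 0, 2, 0, 0, -2, -2, 0, -2, 0, -2, 0, 0, -2, 2, 0, 0, -2, 0, 0, 0, 0, 0],
    [0, 0, 0, 0, 0, 2, 0, 0, 2, 0, 2, 0, 2, 0, 0, 0, 0, 2, 0, 2, 2, 2, 0, 0],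
    [2, 0, 0, 0, 0, 2, -2, 0, 2, 0, 0, 0, 2, 0, -2, 0, 0, 0, 0, 0, 0, 2, 0, 2],
    [0, -2, -2, 0, 0, 2, -2, 0, 0, 0, 0, -2, 0, 0, -2, 0, 0, 0, -2, 0, 0, 2, 0, 0]],
   [[1, 1, -1, 1, 1, 3, -3, -3, -1, -3, -1, -1, 1, -3, -3, 1, -1, 1, -1, 3, 1, 1, 1, 1],
    [3, -1, -1, 1, 1, 1, -5, -3, -1, -3, -1, -1, 1, -3, -3, 1, -1, 1, -3, 3, -1, 1, -1, 3],
    [-1, 1, -1, -1, 3, 3, -3, -1, 1, -3, 1, -1, 3, -1, -1, -1, -1, 1, -1, 3, 1, 3, 1, -1],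
    [1, -1, -1, -1, 1, 3, -3, -1, 1, -3, -1, -1, 3, -1, -3, -1, -1, 1, -3, 3, 1, 1, 1, 1],
    [1, 1, 1, -1, 3, 3, -3, -1, 1, -3, -1, -1, 1, -3, -1, -1, -1, 3, -1, 3, 1, 1, 1, 1],
    [-1, 1, -1, -1, 1, 3, -3, -3, 1, -3, -1, -1, 1, -3, -1, -1, -1, 1, -3, 3, -1, 1, 1, -1],
    [1, -1, -1, 3, 1, 3, -3, -3, -1, -5, -1, -1, 1, -3, -3, 3, -1, 1, -3, 1, -1, 1, -1, 1],
    [1, 1, -1, 1, 1, 3, -3, -1, 1, -3, -1, -1, 3, -1, -1, 1, 1, 3, -1, 3, 1, 3, 1, 1],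
    [-1, 1, -1, 1, 1, 3, -3, -1, 1, -3, -1, -1, 1, -1, -3, 1, -1, 1, -3, 3, 1, 3, -1, -1],
    [-1, 1, -1, 1, 3, 3, -3, -3, 1, -3, -1, 1, 1, -1, -1, 1, -1, 3, -1, 3, 1, 1, 1, -1]],
   [[6, 0, -2, 2, 2, 4, -6, -4, 0, -6, -2, -2, 2, -4, -4, 0, -2, 2, -4, 4, 0, 2, 0, 4],
    [2, 0, -2, -2, 2, 4, -6, -4, 0, -6, -2, -2, 2, -4, -4, 0, -2, 2, -4, 4, 0, 2, 0, 4]],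
   [[3, 1, -1, 1, 3, 3, -5, -5, -1, -7, -3, -1, 1, -5, -3, 3, -3, 3, -3, 5, -1, 1, 1, 1],
    [-1, 1, -1, 5, 3, 3, -5, -5, -1, -7, -3, -1, 1, -5, -3, 3, -3, 3, -3, 5, -1, 1, 1, 1]]]

/-- The images of the places under `perm10F`. -/
def image10F : Fin 24 → Fin 24 :=
  ![23, 14, 19, 15, 11, 12, 22, 9, 10, 21, 13, 6, 20, 5, 4, 3, 7, 2, 17, 1, 16, 8, 18, 0]

theorem perm10F_apply (p : Fin 24) : perm10F p = image10F p := by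
  revert p
  decide +kernel

/-- The A_1 components live on the coordinates 0, 23 and 3, 15, the two transpositions of `perm10F`.
-/
theorem certificate10F : glue10F.IsometryCertificate image10F
    1 5 ⟨0, by decide⟩
    (glue10F.ofTable inverse10F) (glue10F.ofTable detect10F)
    ![1, -1, -1, -1, -1, -1, -1, 1, -1, 1, 1, -1, 1, -1, -1, -1, 1, -3, -1, -1, 1, -1, -1, -1] where
  injective := by decide +kernel
  d_ne := by decide +kernel
  c_eq := by decide +kernel
  dvd := by decide +kernel
  norm := by decide +kernel
  coxeter := by decide +kernel
  transitive := by decide +kernel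
  sum_U := by decide +kernel
  equivariant := by decide +kernel
  left_inv := by decide +kernel
  right_inv_ne := by decide +kernel
  right_inv := by decide +kernel
  W_mem := by decide +kernel
  W_fixed := by decide +kernel
  X_mem := by decide +kernel
  X_fixed := by decide +kernel
  gen_mem := by decide +kernel
  root_mem := by decide +kernel
  weight_mem := by decide +kernel

theorem coinvariantIsLB_rep10F : CoinvariantIsLB rep10F glue10F := by
  refine certificate10F.coinvariantIsLB fun x p => ?_
  change (x : Fin 24 → ℚ) (perm10F p) = ((1 : ℤ) : ℚ) * _
  rw [Int.cast_one, one_mul, perm10F_apply]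

theorem propositionP (g : isometryGroup leechForm leech) :
    (IsConj rep4C g → CoinvariantIsLB g glue4C) ∧
    (IsConj rep6E g → CoinvariantIsLB g glue6E) ∧
    (IsConj rep6G g → CoinvariantIsLB g glue6G) ∧
    (IsConj rep8E g → CoinvariantIsLB g glue8E) ∧
    (IsConj rep10F g → CoinvariantIsLB g glue10F) := by
  exact ⟨fun h => .of_isConj h coinvariantIsLB_rep4C,
    fun h => .of_isConj h coinvariantIsLB_rep6E,
    fun h => .of_isConj h coinvariantIsLB_rep6G,
    fun h => .of_isConj h coinvariantIsLB_rep8E,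
    fun h => .of_isConj h coinvariantIsLB_rep10F⟩
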